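/- **Setting.** Let $\mathcal X,\mathcal Y,\mathcal A$ be Borel spaces and $\mathcal D\subset\mathcal X\times\mathcal A$ a set that contains the graph of a measurable map $\mathcal X\to\mathcal A$ and whose sections $\mathcal D(x)=\{a:(x,a)\in\mathcal D\}$ are compact. Let $\lambda\in\mathcal P(\mathcal X)$, $\nu\in\mathcal P(\mathcal Y)$, and let $q(x',y'|x,y,a)\ge 0$, $(x,a)\in\mathcal D$, be bounded, continuous in all arguments and a probability density in $(x',y')$ with respect to $\lambda\otimes\nu$; let $Q(\cdot|x,y,a)$ be the corresponding kernel. Let $Q_0^Y$ be a probability measure on $\mathcal Y$ with a density with respect to $\nu$, $c:\mathcal X\times\mathcal Y\times\mathcal A\to\mathbb R_+$ continuous and bounded, $U:\mathbb R_+\to\mathbb R$ continuous and strictly increasing, and $0<\beta<1$. A policy $\pi=(g_0,g_1,\dots)\in\Pi$ consists of measurable maps $g_n$ that assign to each admissible observable history $h_n=(x_0,a_0,\dots,a_{n-1},x_n)$ (that is, $a_k\in\mathcal D(x_k)$ for $k<n$) an action $g_n(h_n)\in\mathcal D(x_n)$. Let $\mathbb P^\pi_{xy}$ be the law (Ionescu-Tulcea)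 of the state process $(X_n,Y_n)$ started at $(x,y)$, with transition kernel $Q$ and actions $A_n=g_n(X_0,A_0,\dots,X_n)$, and put $$J_{N\pi}(x)=\int_{\mathcal Y}\mathbb E^\pi_{xy}\Big[U\Big(\sum_{k=0}^{N-1}\beta^kc(X_k,Y_k,A_k)\Big)\Big]Q_0^Y(dy),\qquad J_N(x)=\inf_{\pi\in\Pi}J_{N\pi}(x).$$ Let $\mathcal M$ be the set of finite Borel measures on $\mathcal Y\times\mathbb R_+$ with the topology of weak convergence, and $\mathcal S=\mathcal X\times\mathcal M\times(0,1]$. For $(x,a)\in\mathcal D$, $x'\in\mathcal X$, $\mu\in\mathcal M$, $z\ge0$ define $\Psi(x,a,x',\mu,z)\in\mathcal M$ by $$\Psi(x,a,x',\mu,z)(B)=\int\Big(\int_{B}q(x',y'|x,y,a)\,\nu(dy')\,\delta_{s+zc(x,y,a)}(ds')\Big)\mu(dy,ds).$$ For $(x,\mu,z)\in\mathcal S$ and $n\ge0$ put $$V_{n\pi}(x,\mu,z)=\int\mathbb E^\pi_{xy}\Big[U\Big(s+z\sum_{k=0}^{n-1}\beta^kc(X_k,Y_k,A_k)\Big)\Big]\mu(dy,ds),\qquad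 V_n=\inf_{\pi\in\Pi}V_{n\pi},\qquad V_0(x,\mu,z)=\int U(s)\,\mu(dy,ds).$$ Since $U\ge U(0)$, these integrals are well defined in $(-\infty,\infty]$. Given $\mu\in\mathcal M$, $z\in(0,1]$, let $\mu_0^{\mu,z}=\mu$ and $\mu^{\mu,z}_{n+1}(\cdot|h_n,a,x')=\Psi(x_n,a,x',\mu_n^{\mu,z}(\cdot|h_n),\beta^nz)$; write $\mu_n(\cdot|h_n)$ for the case $\mu=Q_0^Y\times\delta_0$, $z=1$. Let $F$ be the set of Borel measurable $f:\mathcal S\to\mathcal A$ with $f(x,\mu,z)\in\mathcal D(x)$. A Markov policy is a sequence $(f_0,f_1,\dots)$ in $F$; in $V_{n\pi}(x,\mu,z)$ it stands for the policy $g_k(h_k)=f_k(x_k,\mu_k^{\mu,z}(\cdot|h_k),\beta^kz)$. For $f\in F$ let $(T_fv)(x,\mu,z)=\int_{\mathcal X}v\big(x',\Psi(x,f(x,\mu,z),x',\mu,z),\beta z\big)\lambda(dx')$. Let $\mathcal V(\mathcal S)$ be the set of lower semicontinuous $v:\mathcal S\to[-\infty,\infty]$ with $v\ge V_0$. A minimizer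 of $v$ is an $f\in F$ with $$(T_fv)(x,\mu,z)=\inf_{a\in\mathcal D(x)}\int_{\mathcal X}v\big(x',\Psi(x,a,x',\mu,z),\beta z\big)\lambda(dx')\quad\text{for all }(x,\mu,z)\in\mathcal S.$$ **Theorem.** (a) For every Markov policy $\pi=(f_0,f_1,\dots)$ the policies $(g_k)$ that it stands for are well defined elements of $\Pi$, and $V_{n\pi}=T_{f_0}\cdots T_{f_{n-1}}V_0$ for all $n\ge0$. Suppose in addition that the set-valued map $x\mapsto\mathcal D(x)$ is upper semicontinuous. Then: (b) For all $n\ge0$: $V_n\in\mathcal V(\mathcal S)$; $V_n>-\infty$, and $V_n(x,\mu,z)$ is finite whenever $\int|U(s+t)|\,\mu(dy,ds)<\infty$ for all $t\ge0$; and $$V_{n+1}(x,\mu,z)=\inf_{a\in\mathcal D(x)}\int_{\mathcal X}V_n\big(x',\Psi(x,a,x',\mu,z),\beta z\big)\lambda(dx'),\qquad(x,\mu,z)\in\mathcal S.$$ (c) For every $n\ge1$ there is a minimizer $f_n^*\in F$ of $V_{n-1}$. For every $N\ge0$ and every choice of minimizers $f_n^*$ of $V_{n-1}$, $1\le n\le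 N$, the maps $g_n^*(h_n)=f^*_{N-n}\big(x_n,\mu_n(\cdot|h_n),\beta^n\big)$, $0\le n\le N-1$, are the first $N$ components of a policy in $\Pi$, and any such policy $\pi^*$ is optimal: $J_{N\pi^*}(x)=J_N(x)$ for all $x\in\mathcal X$. -/

import Mathlib

open MeasureTheory ProbabilityTheory Set Topology
open scoped NNReal ENNReal

set_option linter.unusedSectionVars false

noncomputable section

/-- The integral `∫ f⁺ dm - ∫ f⁻ dm` of an extended-real function. -/
def erealIntegral {Ω : Type*} [MeasurableSpace Ω] (m : Measure Ω) (f : Ω → EReal) : EReal :=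
  ((∫⁻ ω, (f ω).toENNReal ∂m : ℝ≥0∞) : EReal) - ((∫⁻ ω, (-f ω).toENNReal ∂m : ℝ≥0∞) : EReal)

/-- The data of the risk-sensitive partially observable Markov decision process: observable states
`X`, unobservable states `Y`, actions `A`.  `D` is the set of admissible pairs `(x, a)`,
`q x' y' (x, a) y` is the transition density `q(x', y' | x, y, a)` with respect to `lam ⊗ nu`,
`q0` the density of the law of `Y₀` with respect to `nu`, `c` the stage cost, `U` the utility
and `β` the discount factor. -/
structure RSPOMDP (X Y A : Type*)
    [TopologicalSpace X] [MeasurableSpace X]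
    [TopologicalSpace Y] [MeasurableSpace Y]
    [TopologicalSpace A] [MeasurableSpace A] where
  D : Set (X × A)
  exists_selector : ∃ f : X → A, Measurable f ∧ ∀ x, (x, f x) ∈ D
  isCompact_D : ∀ x, IsCompact {a | (x, a) ∈ D}
  lam : ProbabilityMeasure X
  nu : ProbabilityMeasure Y
  q : X → Y → D → Y → ℝ≥0
  continuous_q : Continuous fun p : X × Y × D × Y => q p.1 p.2.1 p.2.2.1 p.2.2.2
  bounded_q : ∃ C : ℝ≥0, ∀ x' y' d y, q x' y' d y ≤ C
  lintegral_q : ∀ d y,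
    ∫⁻ p, (q p.1 p.2 d y : ℝ≥0∞) ∂((lam : Measure X).prod (nu : Measure Y)) = 1
  q0 : Y → ℝ≥0
  measurable_q0 : Measurable q0
  lintegral_q0 : ∫⁻ y, (q0 y : ℝ≥0∞) ∂(nu : Measure Y) = 1
  c : X → Y → A → ℝ≥0
  continuous_c : Continuous fun p : X × Y × A => c p.1 p.2.1 p.2.2
  bounded_c : ∃ C : ℝ≥0, ∀ x y a, c x y a ≤ C
  U : ℝ≥0 → ℝ
  continuous_U : Continuous U
  strictMono_U : StrictMono U
  β : ℝ≥0
  β_pos : 0 < β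
  β_lt_one : β < 1

namespace RSPOMDP

variable {X Y A : Type*}
  [TopologicalSpace X] [MeasurableSpace X]
  [TopologicalSpace Y] [MeasurableSpace Y]
  [TopologicalSpace A] [MeasurableSpace A]
  (M : RSPOMDP X Y A)

/-- The feasible actions `D(x)`. -/
def feasible (x : X) : Set A := {a | (x, a) ∈ M.D}

/-- The discount factor as an element of `(0, 1]`. -/
def disc : Ioc (0 : ℝ≥0) 1 := ⟨M.β, M.β_pos, M.β_lt_one.le⟩

/-- The law of the initial unobservable state `Y₀`. -/
def initY : Measure Y := (M.nu : Measure Y).withDensity fun y => (M.q0 y : ℝ≥0∞)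

instance : IsProbabilityMeasure M.initY where
  measure_univ := by simp [initY, M.lintegral_q0]

/-- Admissible observable histories `h_n = (x₀, a₀, …, x_{n-1}, a_{n-1}, x_n)`: the pairs
`(x_k, a_k) ∈ D` for `k < n`, and the current state `x_n`. -/
abbrev Hist (n : ℕ) : Type _ := (Fin n → M.D) × X

/-- The history `h_n` contained in `h_{n+1}`. -/
def Hist.prev {M : RSPOMDP X Y A} {n : ℕ} (h : M.Hist (n + 1)) : M.Hist n :=
  (fun i => h.1 i.castSucc, (h.1 (Fin.last n)).1.1)

/-- History-dependent control policies `π = (g₀, g₁, …)`. -/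
structure Policy where
  g : (n : ℕ) → M.Hist n → A
  measurable_g : ∀ n, Measurable (g n)
  feasible_g : ∀ n (h : M.Hist n), (h.2, g n h) ∈ M.D

variable {M}

/-- The admissible pair `(x_n, g_n(h_n))`. -/
def Policy.pair (π : M.Policy) (n : ℕ) (h : M.Hist n) : M.D := ⟨(h.2, π.g n h), π.feasible_g n h⟩

lemma Policy.measurable_pair (π : M.Policy) (n : ℕ) : Measurable (π.pair n) :=
  (measurable_snd.prodMk (π.measurable_g n)).subtype_mk

/-- The history up to time `n` along a trajectory of states, when actions are chosen by `π`. -/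
def Policy.hist (π : M.Policy) : (n : ℕ) → (ℕ → X × Y) → M.Hist n
  | 0, ω => (Fin.elim0, (ω 0).1)
  | n + 1, ω => (Fin.snoc (π.hist n ω).1 (π.pair n (π.hist n ω)), (ω (n + 1)).1)

lemma Policy.measurable_hist (π : M.Policy) (n : ℕ) : Measurable (π.hist n) := by
  induction n with
  | zero =>
    refine Measurable.prodMk (measurable_pi_lambda _ fun i => i.elim0) ?_
    exact (measurable_pi_apply 0).fst
  | succ n ih =>
    refine Measurable.prodMk (measurable_pi_lambda _ fun i => ?_) (measurable_pi_apply (n + 1)).fst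
    refine Fin.lastCases ?_ (fun j => ?_) i
    · simpa [Fin.snoc_last, Function.comp_def] using (π.measurable_pair n).comp ih
    · simpa [Fin.snoc_castSucc, Function.comp_def] using (measurable_pi_apply j).comp ih.fst

/-- The action `A_n = g_n(X₀, A₀, …, A_{n-1}, X_n)` along a trajectory. -/
def Policy.action (π : M.Policy) (n : ℕ) (ω : ℕ → X × Y) : A := π.g n (π.hist n ω)

/-- Extends a trajectory up to time `n` to all times (constantly after `n`). -/
def extend (n : ℕ) (u : Finset.Iic n → X × Y) (i : ℕ) : X × Y :=
  u ⟨min i n, Finset.mem_Iic.2 (min_le_right i n)⟩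

lemma measurable_extend (n : ℕ) : Measurable (extend (X := X) (Y := Y) n) :=
  measurable_pi_lambda _ fun _ => measurable_pi_apply _

section Law

variable [SecondCountableTopology X] [BorelSpace X] [SecondCountableTopology Y] [BorelSpace Y]
  [SecondCountableTopology A] [BorelSpace A]

variable (M) in
lemma measurable_density : Measurable (Function.uncurry
    fun (p : M.D × Y) (r : X × Y) => (M.q r.1 r.2 p.1 p.2 : ℝ≥0∞)) := by
  have h : Continuous fun t : (M.D × Y) × (X × Y) =>
      (M.q t.2.1 t.2.2 t.1.1 t.1.2 : ℝ≥0∞) := by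
    refine ENNReal.continuous_coe.comp (M.continuous_q.comp (g := fun p : X × Y × M.D × Y =>
      M.q p.1 p.2.1 p.2.2.1 p.2.2.2)
      (f := fun t : (M.D × Y) × (X × Y) => (t.2.1, t.2.2, t.1.1, t.1.2)) ?_)
    fun_prop
  exact h.measurable

variable (M) in
/-- The transition kernel `Q(· | x, y, a)`. -/
def Q : Kernel (M.D × Y) (X × Y) :=
  Kernel.withDensity (Kernel.const _ ((M.lam : Measure X).prod (M.nu : Measure Y)))
    fun p r => (M.q r.1 r.2 p.1 p.2 : ℝ≥0∞)

instance : IsMarkovKernel M.Q where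
  isProbabilityMeasure p := by
    refine ⟨?_⟩
    rw [Q, Kernel.withDensity_apply' _ M.measurable_density]
    simpa using M.lintegral_q p.1 p.2

/-- The kernel of `(X_{n+1}, Y_{n+1})` given the states up to time `n`, under `π`. -/
def Policy.step (π : M.Policy) (n : ℕ) : Kernel (Finset.Iic n → X × Y) (X × Y) :=
  M.Q.comap (fun u => (π.pair n (π.hist n (extend n u)), (extend n u n).2))
    (((π.measurable_pair n).comp ((π.measurable_hist n).comp (measurable_extend n))).prodMk
      (((measurable_pi_apply n).comp (measurable_extend n)).snd))

instance (π : M.Policy) (n : ℕ) : IsMarkovKernel (π.step n) := by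
  unfold Policy.step; infer_instance

/-- The law `ℙ^π_{xy}` of the state trajectory, from the Ionescu-Tulcea theorem. -/
def Policy.law (π : M.Policy) (x : X) (y : Y) : Measure (ℕ → X × Y) :=
  Kernel.traj (X := fun _ => X × Y) π.step 0 (fun _ => (x, y))

/-- The discounted cost `∑_{k<n} β^k c(X_k, Y_k, A_k)` along a trajectory. -/
def Policy.cost (π : M.Policy) (n : ℕ) (ω : ℕ → X × Y) : ℝ≥0 :=
  ∑ k ∈ Finset.range n, M.β ^ k * M.c (ω k).1 (ω k).2 (π.action k ω)

/-- The objective `J_{Nπ}(x)`. -/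
def J (N : ℕ) (π : M.Policy) (x : X) : ℝ :=
  ∫ y, (∫ ω, M.U (π.cost N ω) ∂(π.law x y)) ∂M.initY

variable (M) in
/-- The optimal value `J_N(x)`. -/
def Jopt (N : ℕ) (x : X) : ℝ := ⨅ π : M.Policy, J N π x

variable (X Y) in
/-- The state space `X × ℳ(Y × ℝ₊) × (0, 1]`, where `ℳ` denotes the finite measures with the
topology of weak convergence. -/
abbrev State : Type _ := X × FiniteMeasure (Y × ℝ≥0) × Ioc (0 : ℝ≥0) 1

/-- The value `V_{nπ}(x, μ, z)` of a policy. -/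
def Vpol (n : ℕ) (π : M.Policy) (σ : State X Y) : EReal :=
  erealIntegral (σ.2.1 : Measure (Y × ℝ≥0)) fun p =>
    ((∫ ω, M.U (p.2 + (σ.2.2 : ℝ≥0) * π.cost n ω) ∂(π.law σ.1 p.1) : ℝ) : EReal)

variable (M) in
/-- The value function `V_n`. -/
def V (n : ℕ) (σ : State X Y) : EReal := ⨅ π : M.Policy, Vpol n π σ

variable (M) in
/-- The terminal cost `V₀(x, μ, z) = ∫ U(s) μ(dy, ds)`. -/
def V0 (σ : State X Y) : EReal :=
  erealIntegral (σ.2.1 : Measure (Y × ℝ≥0)) fun p => (M.U p.2 : EReal)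

variable (M) in
/-- The set `𝒱(S)` of lower semicontinuous functions that dominate `V₀`. -/
def classV : Set (State X Y → EReal) := {v | LowerSemicontinuous v ∧ ∀ σ, M.V0 σ ≤ v σ}

variable (M) in
/-- The update rule `Ψ(x, a, x', μ, z)` at `d = (x, a)`: the image, under
`((y, s), y') ↦ (y', s + z c(x, y, a))`, of the measure `q(x', y' | x, y, a) μ(dy, ds) ν(dy')`. -/
def Ψ (d : M.D) (x' : X) (μ : FiniteMeasure (Y × ℝ≥0)) (z : ℝ≥0) : FiniteMeasure (Y × ℝ≥0) :=
  ⟨(((μ : Measure (Y × ℝ≥0)).prod (M.nu : Measure Y)).withDensity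
      fun t => (M.q x' t.2 d t.1.1 : ℝ≥0∞)).map
        fun t => (t.2, t.1.2 + z * M.c d.1.1 t.1.1 d.1.2), by
    obtain ⟨C, hC⟩ := M.bounded_q
    have : IsFiniteMeasure (((μ : Measure (Y × ℝ≥0)).prod (M.nu : Measure Y)).withDensity
        fun t => (M.q x' t.2 d t.1.1 : ℝ≥0∞)) := by
      refine isFiniteMeasure_withDensity (ne_of_lt ?_)
      calc ∫⁻ t, (M.q x' t.2 d t.1.1 : ℝ≥0∞) ∂((μ : Measure (Y × ℝ≥0)).prod (M.nu : Measure Y))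
          ≤ ∫⁻ _, (C : ℝ≥0∞) ∂((μ : Measure (Y × ℝ≥0)).prod (M.nu : Measure Y)) :=
            lintegral_mono fun t => ENNReal.coe_le_coe.2 (hC _ _ _ _)
        _ < ⊤ := by
            rw [lintegral_const]
            exact ENNReal.mul_lt_top ENNReal.coe_lt_top (measure_lt_top _ _)
    infer_instance⟩

/-- The update rule as an iterated integral: `Ψ(x, a, x', μ, z)(B)` equals
`∫∫ (∫_B q(x', y' | x, y, a) ν(dy') δ_{s + z c(x, y, a)}(ds')) μ(dy, ds)`. -/
lemma Ψ_apply (d : M.D) (x' : X) (μ : FiniteMeasure (Y × ℝ≥0)) (z : ℝ≥0)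
    {B : Set (Y × ℝ≥0)} (hB : MeasurableSet B) :
    (M.Ψ d x' μ z : Measure (Y × ℝ≥0)) B =
      ∫⁻ p, (((M.nu : Measure Y).withDensity fun y' => (M.q x' y' d p.1 : ℝ≥0∞)).prod
        (Measure.dirac (p.2 + z * M.c d.1.1 p.1 d.1.2))) B ∂(μ : Measure (Y × ℝ≥0)) := by
  have hc : Continuous fun y : Y => M.c d.1.1 y d.1.2 :=
    M.continuous_c.comp (g := fun p : X × Y × A => M.c p.1 p.2.1 p.2.2)
      (f := fun y : Y => (d.1.1, y, d.1.2)) (by fun_prop)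
  have hq : Continuous fun t : (Y × ℝ≥0) × Y => (M.q x' t.2 d t.1.1 : ℝ≥0∞) :=
    ENNReal.continuous_coe.comp (M.continuous_q.comp (g := fun p : X × Y × M.D × Y =>
      M.q p.1 p.2.1 p.2.2.1 p.2.2.2)
      (f := fun t : (Y × ℝ≥0) × Y => (x', t.2, d, t.1.1)) (by fun_prop))
  have hmap : Measurable fun t : (Y × ℝ≥0) × Y => (t.2, t.1.2 + z * M.c d.1.1 t.1.1 d.1.2) := by
    have := hc.measurable
    fun_prop
  change Measure.map _ _ B = _
  rw [Measure.map_apply hmap hB, withDensity_apply _ (hmap hB), ← lintegral_indicator (hmap hB),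
    lintegral_prod _ ((hq.measurable.indicator (hmap hB)).aemeasurable)]
  refine lintegral_congr fun p => ?_
  have hs : MeasurableSet {y' : Y | (y', p.2 + z * M.c d.1.1 p.1 d.1.2) ∈ B} :=
    (measurable_id.prodMk measurable_const) hB
  have hqy : Measurable fun y' : Y => (M.q x' y' d p.1 : ℝ≥0∞) :=
    hq.measurable.comp (measurable_const.prodMk measurable_id)
  have : SFinite ((M.nu : Measure Y).withDensity fun y' => (M.q x' y' d p.1 : ℝ≥0∞)) := inferInstance
  rw [Measure.prod_dirac, Measure.map_apply (by fun_prop) hB]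
  change _ = ((M.nu : Measure Y).withDensity _) {y' : Y | (y', _) ∈ B}
  rw [withDensity_apply _ hs, ← lintegral_indicator hs]
  rfl

variable (M) in
/-- The initial information state `Q₀^Y × δ₀`. -/
def infoInit : FiniteMeasure (Y × ℝ≥0) := ⟨M.initY.prod (Measure.dirac 0), inferInstance⟩

/-- The information states `μ_n(· | h_n)` started at `μ` with scale `z`: `μ_0 = μ` and
`μ_{n+1}(· | h_n, a, x') = Ψ(x_n, a, x', μ_n(· | h_n), β^n z)`. -/
def infoState (μ : FiniteMeasure (Y × ℝ≥0)) (z : Ioc (0 : ℝ≥0) 1) :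
    (n : ℕ) → M.Hist n → FiniteMeasure (Y × ℝ≥0)
  | 0, _ => μ
  | n + 1, h =>
      M.Ψ (h.1 (Fin.last n)) h.2 (infoState μ z n h.prev) ((M.disc ^ n * z : Ioc (0 : ℝ≥0) 1) : ℝ≥0)

variable (M) in
/-- Strategies `f : S → A` (Borel measurable, with `f(x, μ, z) ∈ D(x)`). -/
structure Strategy where
  f : State X Y → A
  measurable_f : Measurable[borel (State X Y)] f
  feasible_f : ∀ σ, (σ.1, f σ) ∈ M.D

variable (M) in
/-- `∫ v(x', Ψ(x, a, x', μ, z), βz) λ(dx')` for `d = (x, a)`. -/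
def expNext (v : State X Y → EReal) (d : M.D) (μ : FiniteMeasure (Y × ℝ≥0))
    (z : Ioc (0 : ℝ≥0) 1) : EReal :=
  erealIntegral (M.lam : Measure X) fun x' => v (x', M.Ψ d x' μ (z : ℝ≥0), M.disc * z)

/-- The operator `T_f`. -/
def T (f : M.Strategy) (v : State X Y → EReal) (σ : State X Y) : EReal :=
  M.expNext v ⟨(σ.1, f.f σ), f.feasible_f σ⟩ σ.2.1 σ.2.2

variable (M) in
/-- `inf_{a ∈ D(x)} ∫ v(x', Ψ(x, a, x', μ, z), βz) λ(dx')`. -/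
def bellman (v : State X Y → EReal) (σ : State X Y) : EReal :=
  ⨅ a : M.feasible σ.1, M.expNext v ⟨(σ.1, (a : A)), a.2⟩ σ.2.1 σ.2.2

/-- `f` is a minimizer of `v`: it attains the infimum over `D(x)` in every state. -/
def Strategy.IsMinimizer (f : M.Strategy) (v : State X Y → EReal) : Prop :=
  ∀ σ, T f v σ = M.bellman v σ

/-- The iterated cost `T_{f_0} ⋯ T_{f_{n-1}} V₀` of a Markov policy `(f_0, f_1, …)`. -/
def iterT : ℕ → (ℕ → M.Strategy) → State X Y → EReal
  | 0, _ => M.V0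
  | n + 1, f => T (f 0) (iterT n fun k => f (k + 1))

/-- `π` applies the Markov policy `(f_0, f_1, …)` of the information-state process started in
`(x, μ, z)`: `g_k(h_k) = f_k(x_k, μ_k(· | h_k), β^k z)`. -/
def Policy.Follows (π : M.Policy) (f : ℕ → M.Strategy) (μ : FiniteMeasure (Y × ℝ≥0))
    (z : Ioc (0 : ℝ≥0) 1) : Prop :=
  ∀ k (h : M.Hist k), π.g k h = (f k).f (h.2, infoState μ z k h, M.disc ^ k * z)

end Law

end RSPOMDP

end

/-!
The proof passes to the nonnegative utility `U + U(0)⁻`, so that all values become Lebesgue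
integrals in `[0, ∞]`. Because `q(·, · | x, y, a)` is a probability density, the update `Ψ`
preserves the total mass of the information state in `λ`-mean; hence the values for `U` differ
from those for the nonnegative utility by `U(0)⁻ μ(Y × ℝ₊)` throughout (`Vpol_eq`,
`expNext_ofPos`), and this offset is finite and continuous in `μ`.

**Policies.** Conditioning on the first transition (`Policy.lintegral_law_first`) turns the law of
the trajectory under `π` into the transition kernel followed by the law under the policy shifted
by one step. Together with Tonelli's theorem (`lintegral_lintegral_Ψ`) this gives
`V_{n+1,π}(x, μ, z) = ∫ V_{n,π'}(x', Ψ(x, g₀(x), x', μ, z), βz) λ(dx')` (`Vpol_succ`), where the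
shifted policy `π'` depends on `x` but not on `x'`. For Markov policies, the information states of
the shifted policy are those restarted at `Ψ(x, g₀(x), x', μ, z)`, and the cost iteration follows
by induction (`Vpol_eq_iterT`). For arbitrary policies the same recursion shows that `V_{nπ}` is at least the
`n`-th Bellman iterate (`posV_le_posVpol`).

**Minimizers.** The space of finite measures on `Y × ℝ₊` is pseudo-metrizable, which reduces lower
semicontinuity of `∫ v(x', Ψ(x, a, x', μ, z), βz) λ(dx')` in `(x, a, μ, z)` to Fatou's lemma along
sequences, given that `Ψ` is jointly continuous (`continuous_Ψ`). Minimizing over the compact sets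
`D(x)`, which depend on `x` upper hemicontinuously, preserves lower semicontinuity by the tube
lemma, and the compact sets of minimizing actions have a Borel selector
(`exists_measurable_minimizer`). The Markov policy made of such minimizers attains the Bellman
iterates, so these are the value functions (`V_eq`).

**Optimality.** `J_{Nπ}(x)` is `V_{Nπ}` at the information state `Q₀^Y × δ₀` with scale `1`
(`Vpol_infoInit`), so that a policy built from minimizers of the value functions is optimal.
-/

noncomputable section

/-! ### The weak topology on finite measures -/

section FiniteMeasureTopology

open TopologicalSpace Filter

variable {E : Type*} [TopologicalSpace E] [MeasurableSpace E]

/-- The probability measure obtained by adding a unit point mass at `e` to a finite measure and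
normalizing; the point mass keeps the normalization meaningful at the zero measure. -/
def addDiracNormalize [Nonempty E] (e : E) (μ : FiniteMeasure E) : ProbabilityMeasure E :=
  (μ + (diracProba e).toFiniteMeasure).normalize

lemma mass_add_dirac (e : E) (μ : FiniteMeasure E) :
    (μ + (diracProba e).toFiniteMeasure).mass = μ.mass + 1 := by
  simp [FiniteMeasure.mass]

lemma tendsto_add_dirac_iff [OpensMeasurableSpace E] (e : E) {γ : Type*} {F : Filter γ}
    {μs : γ → FiniteMeasure E} {μ : FiniteMeasure E} :
    Tendsto (fun i => μs i + (diracProba e).toFiniteMeasure) F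
      (𝓝 (μ + (diracProba e).toFiniteMeasure)) ↔ Tendsto μs F (𝓝 μ) := by
  rw [FiniteMeasure.tendsto_iff_forall_integral_tendsto,
    FiniteMeasure.tendsto_iff_forall_integral_tendsto]
  refine forall_congr' fun f => ?_
  have h : ∀ ν : FiniteMeasure E, ∫ x, f x ∂((ν + (diracProba e).toFiniteMeasure :
      FiniteMeasure E) : Measure E) = ∫ x, f x ∂(ν : Measure E) + f e := by
    intro ν
    rw [FiniteMeasure.toMeasure_add, integral_add_measure (f.integrable _) (f.integrable _)]
    congr 1
    exact integral_dirac' _ _ f.continuous.stronglyMeasurable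
  simp only [h]
  exact tendsto_add_const_iff (f e)

/-- The weak topology on finite measures is induced by the total mass together with a
normalization that is defined for the zero measure as well. -/
lemma isInducing_mass_addDiracNormalize [OpensMeasurableSpace E] [Nonempty E] (e : E) :
    IsInducing fun μ : FiniteMeasure E => (μ.mass, addDiracNormalize e μ) := by
  refine isInducing_iff_nhds.2 fun μ => ?_
  have key : ∀ F : Filter (FiniteMeasure E), F ≤ 𝓝 μ ↔
      Tendsto (fun μ : FiniteMeasure E => (μ.mass, addDiracNormalize e μ)) F
        (𝓝 (μ.mass, addDiracNormalize e μ)) := by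
    intro F
    have h0 : μ + (diracProba e).toFiniteMeasure ≠ 0 := by
      rw [← FiniteMeasure.mass_nonzero_iff, mass_add_dirac]
      positivity
    rw [← tendsto_id', ← tendsto_add_dirac_iff e,
      ← FiniteMeasure.tendsto_normalize_iff_tendsto h0, nhds_prod_eq, tendsto_prod_iff', and_comm]
    simp only [mass_add_dirac]
    refine and_congr ?_ Iff.rfl
    constructor
    · intro h
      have := h.sub_const 1
      simpa using this
    · exact fun h => h.add_const 1
  exact le_antisymm (map_le_iff_le_comap.1 ((key _).1 le_rfl))
    ((key _).2 (map_le_iff_le_comap.2 le_rfl))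

/-- The pseudo-metrizability of the weak topology carries over from probability measures, where
the Lévy-Prokhorov metric provides it. -/
instance [SecondCountableTopology E] [PseudoMetrizableSpace E] [OpensMeasurableSpace E] :
    PseudoMetrizableSpace (FiniteMeasure E) := by
  rcases isEmpty_or_nonempty E with hE | hE
  · have : Subsingleton (FiniteMeasure E) :=
      ⟨fun μ ν => FiniteMeasure.toMeasure_injective (Subsingleton.elim _ _)⟩
    have : DiscreteTopology (FiniteMeasure E) := Subsingleton.discreteTopology
    infer_instance
  · exact (isInducing_mass_addDiracNormalize hE.some).pseudoMetrizableSpace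

/-- Joint continuity of the integral of a bounded continuous function of a parameter and a point,
against a weakly varying finite measure. -/
lemma continuous_integral_param [SecondCountableTopology E] [PseudoMetrizableSpace E]
    [OpensMeasurableSpace E] {P : Type*} [TopologicalSpace P] [SecondCountableTopology P]
    [PseudoMetrizableSpace P] {F : P → E → ℝ} (hF : Continuous (Function.uncurry F))
    {C : ℝ} (hC : ∀ p e, |F p e| ≤ C) :
    Continuous fun t : P × FiniteMeasure E => ∫ e, F t.1 e ∂(t.2 : Measure E) := by
  rcases isEmpty_or_nonempty E with hE | ⟨⟨e₀⟩⟩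
  · have : ∀ μ : Measure E, μ = 0 := fun μ => Subsingleton.elim _ _
    simp [this, continuous_const]
  have : Nonempty E := ⟨e₀⟩
  let _ : MeasurableSpace P := borel P
  have : BorelSpace P := ⟨rfl⟩
  let G : BoundedContinuousFunction (P × E) ℝ :=
    BoundedContinuousFunction.ofNormedAddCommGroup (Function.uncurry F) hF C fun p => hC p.1 p.2
  -- `μ = (mass μ + 1) • ι μ - δ_{e₀}` with `ι μ` the probability measure `addDiracNormalize e₀ μ`
  have hrepr : ∀ t : P × FiniteMeasure E, ∫ e, F t.1 e ∂(t.2 : Measure E) =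
      (t.2.mass + 1 : ℝ) * ∫ q, G q ∂((diracProba t.1).prod (addDiracNormalize e₀ t.2) :
        Measure (P × E)) - F t.1 e₀ := by
    rintro ⟨p, μ⟩
    have hcont : Continuous (F p) := hF.comp (by fun_prop : Continuous fun e : E => (p, e))
    have hint : ∀ (m : Measure E) [IsFiniteMeasure m], Integrable (F p) m := fun m _ =>
      (BoundedContinuousFunction.ofNormedAddCommGroup (F p) hcont C (hC p)).integrable m
    have h1 : ∫ q, G q ∂((diracProba p).prod (addDiracNormalize e₀ μ) : Measure (P × E)) =
        ∫ e, F p e ∂(addDiracNormalize e₀ μ : Measure E) := by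
      rw [ProbabilityMeasure.toMeasure_prod]
      change ∫ q, G q ∂((Measure.dirac p).prod _) = _
      rw [integral_prod _ (G.integrable _), integral_dirac' _ _ ?_]
      · rfl
      · exact (G.continuous.stronglyMeasurable).integral_prod_right'
    have h2 := congrArg (fun ν : FiniteMeasure E => ∫ e, F p e ∂(ν : Measure E))
      (FiniteMeasure.self_eq_mass_smul_normalize (μ + (diracProba e₀).toFiniteMeasure))
    simp only [mass_add_dirac, FiniteMeasure.toMeasure_smul, FiniteMeasure.toMeasure_add] at h2
    rw [integral_add_measure (hint _) (hint _), integral_smul_nnreal_measure] at h2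
    have h3 : ∫ e, F p e ∂((diracProba e₀).toFiniteMeasure : Measure E) = F p e₀ :=
      integral_dirac' _ _ hcont.stronglyMeasurable
    rw [h3] at h2
    simp only [h1]
    rw [eq_sub_iff_add_eq, h2]
    simp [NNReal.smul_def, addDiracNormalize]
  simp only [hrepr]
  have hι : Continuous fun μ : FiniteMeasure E => addDiracNormalize e₀ μ :=
    continuous_snd.comp (isInducing_mass_addDiracNormalize e₀).continuous
  have hprod : Continuous fun t : P × FiniteMeasure E =>
      (diracProba t.1).prod (addDiracNormalize e₀ t.2) :=
    ProbabilityMeasure.continuous_prod.comp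
      ((continuous_diracProba.comp continuous_fst).prodMk (hι.comp continuous_snd))
  have hI := ProbabilityMeasure.continuous_iff_forall_continuous_integral.1 hprod G
  have hFe : Continuous fun t : P × FiniteMeasure E => F t.1 e₀ :=
    hF.comp (by fun_prop : Continuous fun t : P × FiniteMeasure E => (t.1, e₀))
  have hm : Continuous fun t : P × FiniteMeasure E => (t.2.mass + 1 : ℝ) := by fun_prop
  exact (hm.mul hI).sub hFe

/-- Integrals of lower semicontinuous functions of a parameter are lower semicontinuous, by Fatou's
lemma. -/
lemma lowerSemicontinuous_lintegral {Ω P : Type*} [TopologicalSpace P]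
    [FirstCountableTopology P] [MeasurableSpace Ω] (m : Measure Ω) {w : Ω → P → ℝ≥0∞}
    (hmeas : ∀ p, Measurable fun ω => w ω p) (hw : ∀ ω, LowerSemicontinuous (w ω)) :
    LowerSemicontinuous fun p => ∫⁻ ω, w ω p ∂m := by
  intro p y hy
  by_contra hcon
  obtain ⟨ps, hps, hle⟩ := exists_seq_forall_of_frequently (not_eventually.1 hcon)
  refine absurd hy (not_lt.2 ?_)
  calc ∫⁻ ω, w ω p ∂m ≤ ∫⁻ ω, liminf (fun n => w ω (ps n)) atTop ∂m := by
        refine lintegral_mono fun ω => (Filter.le_liminf_iff'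
          (by isBoundedDefault) (by isBoundedDefault)).2 fun y' hy' => ?_
        exact (hps.eventually (hw ω p y' hy')).mono fun n hn => hn.le
    _ ≤ liminf (fun n => ∫⁻ ω, w ω (ps n) ∂m) atTop := lintegral_liminf_le fun n => hmeas (ps n)
    _ ≤ y := by
        refine liminf_le_of_frequently_le' ?_
        exact (Eventually.of_forall fun n => not_lt.1 (hle n)).frequently

/-- The integral of a nonnegative continuous function is lower semicontinuous in the measure. -/
lemma lowerSemicontinuous_lintegral_finiteMeasure [OpensMeasurableSpace E] {g : E → ℝ≥0}
    (hg : Continuous g) :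
    LowerSemicontinuous fun μ : FiniteMeasure E => ∫⁻ e, (g e : ℝ≥0∞) ∂(μ : Measure E) := by
  have h : (fun μ : FiniteMeasure E => ∫⁻ e, (g e : ℝ≥0∞) ∂(μ : Measure E)) =
      fun μ : FiniteMeasure E => ⨆ n : ℕ, ∫⁻ e, ((min (g e) n : ℝ≥0) : ℝ≥0∞) ∂(μ : Measure E) := by
    funext μ
    rw [← lintegral_iSup (fun n => (hg.min continuous_const).measurable.coe_nnreal_ennreal)
      (fun i j hij e => by
        exact ENNReal.coe_le_coe.2 (min_le_min le_rfl (Nat.cast_le.2 hij)))]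
    refine lintegral_congr fun e => le_antisymm ?_ (iSup_le fun n => ?_)
    · obtain ⟨n, hn⟩ := exists_nat_ge (g e)
      exact le_iSup_of_le n (by simp [hn])
    · exact ENNReal.coe_le_coe.2 (min_le_left _ _)
  rw [h]
  refine lowerSemicontinuous_iSup fun n => Continuous.lowerSemicontinuous ?_
  exact FiniteMeasure.continuous_lintegral_boundedContinuousFunction
    (BoundedContinuousFunction.mkOfBound ⟨fun e => min (g e) n, hg.min continuous_const⟩ n
      fun x y => by
        rw [NNReal.dist_eq, abs_le]
        have h1 : ((min (g x) n : ℝ≥0) : ℝ) ≤ n := by exact_mod_cast min_le_right (g x) (n : ℝ≥0)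
        have h2 : ((min (g y) n : ℝ≥0) : ℝ) ≤ n := by exact_mod_cast min_le_right (g y) (n : ℝ≥0)
        have h3 := NNReal.coe_nonneg (min (g x) n)
        have h4 := NNReal.coe_nonneg (min (g y) n)
        constructor <;> simp only [ContinuousMap.coe_mk] <;> linarith)

end FiniteMeasureTopology

/-! ### Lower semicontinuous minimization and measurable selection -/

section Selection

variable {S A : Type*} [TopologicalSpace S] [TopologicalSpace A]

/-- Extending a lower semicontinuous function by `⊤` off a closed set keeps it lower
semicontinuous. -/
lemma lowerSemicontinuous_extend_top {C : Set S} [DecidablePred (· ∈ C)] (hC : IsClosed C)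
    {g : C → ℝ≥0∞} (hg : LowerSemicontinuous g) :
    LowerSemicontinuous fun s => if h : s ∈ C then g ⟨s, h⟩ else ⊤ := by
  rw [lowerSemicontinuous_iff_isClosed_preimage] at hg ⊢
  intro y
  rcases eq_or_ne y ⊤ with rfl | hy
  · simp
  · convert hC.isClosedEmbedding_subtypeVal.isClosedMap _ (hg y) using 1
    ext s
    by_cases h : s ∈ C <;> simp [h, hy]

/-- The value of minimizing a lower semicontinuous function over an upper hemicontinuous
compact-valued correspondence is lower semicontinuous, by the tube lemma. -/
lemma lowerSemicontinuous_biInf {K : S → Set A} (hK : UpperHemicontinuous K)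
    (hcomp : ∀ s, IsCompact (K s)) {H : S × A → ℝ≥0∞} (hH : LowerSemicontinuous H) :
    LowerSemicontinuous fun s => ⨅ a ∈ K s, H (s, a) := by
  intro s y hy
  obtain ⟨y', hyy', hy'⟩ := exists_between hy
  have hsub : ({s} : Set S) ×ˢ K s ⊆ H ⁻¹' Ioi y' := by
    rintro ⟨t, a⟩ ⟨rfl, ha⟩
    exact hy'.trans_le (iInf₂_le a ha)
  obtain ⟨u, w, hu, hw, hsu, hKw, huw⟩ := generalized_tube_lemma isCompact_singleton (hcomp s)
    (hH.isOpen_preimage y') hsub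
  have h1 : ∀ᶠ t in 𝓝 s, K t ⊆ w := by
    have := (upperHemicontinuousAt_iff.1 (hK s)) w (hw.mem_nhdsSet.2 hKw)
    filter_upwards [this] with t ht using subset_of_mem_nhdsSet ht
  filter_upwards [h1, hu.mem_nhds (hsu rfl)] with t ht htu
  refine hyy'.trans_le (le_iInf₂ fun a ha => ?_)
  exact le_of_lt (huw (⟨htu, ht ha⟩ : (t, a) ∈ u ×ˢ w))

open scoped Classical in
/-- Successive shrinking of a correspondence along a sequence `C` of closed sets: `K s` is
intersected with `C n` whenever the result is nonempty. -/
def shrink (K : S → Set A) (C : ℕ → Set A) : ℕ → S → Set A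
  | 0 => K
  | n + 1 => fun s => if (shrink K C n s ∩ C n).Nonempty then shrink K C n s ∩ C n
      else shrink K C n s

variable {K : S → Set A} {C : ℕ → Set A}

lemma shrink_succ_subset (n : ℕ) (s : S) : shrink K C (n + 1) s ⊆ shrink K C n s := by
  simp only [shrink]
  split_ifs
  exacts [inter_subset_left, subset_rfl]

lemma nonempty_shrink (hne : ∀ s, (K s).Nonempty) (n : ℕ) (s : S) :
    (shrink K C n s).Nonempty := by
  induction n with
  | zero => exact hne s
  | succ n ih =>
    simp only [shrink]
    split_ifs with h
    exacts [h, ih]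

lemma isCompact_shrink (hK : ∀ s, IsCompact (K s)) (hC : ∀ n, IsClosed (C n)) (n : ℕ) (s : S) :
    IsCompact (shrink K C n s) := by
  induction n with
  | zero => exact hK s
  | succ n ih =>
    simp only [shrink]
    split_ifs with h
    exacts [ih.inter_right (hC n), ih]

lemma measurableSet_shrink [MeasurableSpace S] (hC : ∀ n, IsClosed (C n))
    (hK : ∀ F, IsClosed F → MeasurableSet {s | (K s ∩ F).Nonempty}) (n : ℕ) {F : Set A}
    (hF : IsClosed F) : MeasurableSet {s | (shrink K C n s ∩ F).Nonempty} := by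
  induction n generalizing F with
  | zero => exact hK F hF
  | succ n ih =>
    have : {s | (shrink K C (n + 1) s ∩ F).Nonempty} =
        ({s | (shrink K C n s ∩ C n).Nonempty} ∩ {s | (shrink K C n s ∩ (C n ∩ F)).Nonempty}) ∪
        ({s | (shrink K C n s ∩ C n).Nonempty}ᶜ ∩ {s | (shrink K C n s ∩ F).Nonempty}) := by
      ext s
      by_cases h : (shrink K C n s ∩ C n).Nonempty <;> simp [shrink, h, inter_assoc]
    rw [this]
    exact ((ih (hC n)).inter (ih ((hC n).inter hF))).union ((ih (hC n)).compl.inter (ih hF))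

/-- A measurable correspondence with nonempty compact values has a measurable selector: shrinking
along the closures of a countable basis leaves a single point in every value. -/
theorem exists_measurable_selector [MeasurableSpace S] [TopologicalSpace.MetrizableSpace A]
    [SecondCountableTopology A] [MeasurableSpace A] [BorelSpace A] {K : S → Set A}
    (hne : ∀ s, (K s).Nonempty) (hcomp : ∀ s, IsCompact (K s))
    (hK : ∀ F, IsClosed F → MeasurableSet {s | (K s ∩ F).Nonempty}) :
    ∃ f : S → A, Measurable f ∧ ∀ s, f s ∈ K s := by
  rcases isEmpty_or_nonempty A with hA | hA
  · have : IsEmpty S := ⟨fun s => hA.elim (hne s).some⟩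
    exact ⟨fun s => isEmptyElim s, measurable_of_empty _, fun s => isEmptyElim s⟩
  obtain ⟨B, hB⟩ : ∃ B : ℕ → Set A, TopologicalSpace.IsTopologicalBasis (range B) := by
    have hc := TopologicalSpace.countable_countableBasis A
    obtain ⟨B, hB⟩ := hc.exists_eq_range (by
      obtain ⟨u, hu, -⟩ := (TopologicalSpace.isBasis_countableBasis A).exists_subset_of_mem_open
        (mem_univ hA.some) isOpen_univ
      exact ⟨u, hu⟩)
    exact ⟨B, hB ▸ TopologicalSpace.isBasis_countableBasis A⟩
  set C : ℕ → Set A := fun n => closure (B n)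
  have hC : ∀ n, IsClosed (C n) := fun n => isClosed_closure
  have hmono : ∀ s, Antitone fun n => shrink K C n s :=
    fun s => antitone_nat_of_succ_le fun n => shrink_succ_subset n s
  have hex : ∀ s, ∃ a, a ∈ ⋂ n, shrink K C n s := fun s =>
    IsCompact.nonempty_iInter_of_sequence_nonempty_isCompact_isClosed _
      (fun n => shrink_succ_subset n s) (fun n => nonempty_shrink hne n s) (hcomp s)
      (fun n => (isCompact_shrink hcomp hC n s).isClosed)
  choose f hf using hex
  -- two points of the intersection would be separated by a closed basic set, and the shrinking
  -- step at that set keeps only one of them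
  have huniq : ∀ s a, a ∈ ⋂ n, shrink K C n s → a = f s := by
    intro s a ha
    by_contra hne'
    obtain ⟨U, hU, haU, hfU⟩ : ∃ U : Set A, IsOpen U ∧ a ∈ U ∧ f s ∉ closure U := by
      obtain ⟨u, v, hu, hv, hau, hfv, huv⟩ := t2_separation hne'
      exact ⟨u, hu, hau, fun h => (huv.closure_left hv).le_bot ⟨h, hfv⟩⟩
    obtain ⟨_, ⟨n, rfl⟩, han, hnU⟩ := hB.exists_subset_of_mem_open haU hU
    have h1 : (shrink K C n s ∩ C n).Nonempty := ⟨a, mem_iInter.1 ha n, subset_closure han⟩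
    have h2 := mem_iInter.1 (hf s) (n + 1)
    simp only [shrink, h1, if_true] at h2
    exact hfU (closure_mono hnU h2.2)
  refine ⟨f, measurable_of_isClosed fun F hF => ?_, fun s => mem_iInter.1 (hf s) 0⟩
  -- by compactness, the single remaining point lies in `F` as soon as all stages meet `F`
  have : f ⁻¹' F = ⋂ n, {s | (shrink K C n s ∩ F).Nonempty} := by
    ext s
    simp only [mem_preimage, mem_iInter, mem_ofPred_eq]
    refine ⟨fun h n => ⟨f s, mem_iInter.1 (hf s) n, h⟩, fun h => ?_⟩
    obtain ⟨a, ha⟩ := IsCompact.nonempty_iInter_of_sequence_nonempty_isCompact_isClosed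
      (fun n => shrink K C n s ∩ F)
      (fun n => inter_subset_inter_left _ (shrink_succ_subset n s)) h
      ((hcomp s).inter_right hF) (fun n => (isCompact_shrink hcomp hC n s).isClosed.inter hF)
    rw [mem_iInter] at ha
    rw [← huniq s a (mem_iInter.2 fun n => (ha n).1)]
    exact (ha 0).2
  rw [this]
  exact MeasurableSet.iInter fun n => measurableSet_shrink hC hK n hF

/-- Borel measurable minimizers of a lower semicontinuous function over an upper hemicontinuous
correspondence with nonempty compact values. -/
theorem exists_measurable_minimizer [MeasurableSpace S] [BorelSpace S]
    [TopologicalSpace.MetrizableSpace A]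
    [SecondCountableTopology A] [MeasurableSpace A] [BorelSpace A] {K : S → Set A}
    (hne : ∀ s, (K s).Nonempty) (hcomp : ∀ s, IsCompact (K s)) (hK : UpperHemicontinuous K)
    {H : S × A → ℝ≥0∞} (hH : LowerSemicontinuous H) :
    ∃ f : S → A, Measurable f ∧ ∀ s, f s ∈ K s ∧ H (s, f s) = ⨅ a ∈ K s, H (s, a) := by
  classical
  have hsec : ∀ s, LowerSemicontinuous fun a => H (s, a) := fun s =>
    hH.comp (by fun_prop)
  have hmin : ∀ (s : S) (F : Set A), IsClosed F → (K s ∩ F).Nonempty →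
      ∃ a ∈ K s ∩ F, ∀ b ∈ K s ∩ F, H (s, a) ≤ H (s, b) := fun s F hF hn =>
    ((hsec s).lowerSemicontinuousOn _).exists_isMinOn hn ((hcomp s).inter_right hF)
  set v : S → ℝ≥0∞ := fun s => ⨅ a ∈ K s, H (s, a)
  have hv : Measurable v := (lowerSemicontinuous_biInf hK hcomp hH).measurable
  have hne' : ∀ s, (K s ∩ {a | H (s, a) ≤ v s}).Nonempty := by
    intro s
    obtain ⟨a, ha, hmin⟩ := hmin s univ isClosed_univ (by simpa using hne s)
    exact ⟨a, ha.1, le_iInf₂ fun b hb => hmin b ⟨hb, trivial⟩⟩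
  have hmeas : ∀ F, IsClosed F → MeasurableSet {s | (K s ∩ {a | H (s, a) ≤ v s} ∩ F).Nonempty} := by
    intro F hF
    -- off `F` the objective is raised to `⊤`, so that minimizing over `K s` means minimizing
    -- over `K s ∩ F`; the states with value `⊤` have to be treated apart
    set G : S × A → ℝ≥0∞ := fun p => if h : p ∈ (univ : Set S) ×ˢ F then H p else ⊤
    have hG : LowerSemicontinuous G := lowerSemicontinuous_extend_top (isClosed_univ.prod hF)
      (hH.comp continuous_subtype_val)
    have hvG : Measurable fun s => ⨅ a ∈ K s, G (s, a) :=
      (lowerSemicontinuous_biInf hK hcomp hG).measurable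
    have hop : IsOpen {s | K s ⊆ Fᶜ} := isOpen_iff_mem_nhds.2 fun s hs => by
      have := (upperHemicontinuousAt_iff.1 (hK s)) Fᶜ (hF.isOpen_compl.mem_nhdsSet.2 hs)
      filter_upwards [this] with t ht using subset_of_mem_nhdsSet ht
    have : {s | (K s ∩ {a | H (s, a) ≤ v s} ∩ F).Nonempty} =
        {s | K s ⊆ Fᶜ}ᶜ ∩ {s | ⨅ a ∈ K s, G (s, a) ≤ v s} := by
      ext s
      constructor
      · rintro ⟨a, ⟨haK, hav⟩, haF⟩
        refine ⟨fun h => h haK haF, (iInf₂_le (f := fun a _ => G (s, a)) a haK).trans ?_⟩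
        simpa [G, haF] using hav
      · rintro ⟨h1, h2⟩
        obtain ⟨b, hbK, hbF⟩ := not_subset.1 h1
        obtain ⟨a, ha, hle⟩ := hmin s F hF ⟨b, hbK, not_not.1 hbF⟩
        refine ⟨a, ⟨ha.1, le_trans (b := ⨅ a ∈ K s, G (s, a)) (le_iInf₂ fun b hb => ?_) h2⟩, ha.2⟩
        by_cases hbF : b ∈ F
        · simpa [G, hbF] using hle b ⟨hb, hbF⟩
        · simp [G, hbF]
    rw [this]
    exact hop.measurableSet.compl.inter (measurableSet_le hvG hv)
  obtain ⟨f, hf, hfK⟩ := exists_measurable_selector hne'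
    (fun s => (hcomp s).inter_right ((hsec s).isClosed_preimage (v s))) hmeas
  exact ⟨f, hf, fun s => ⟨(hfK s).1, le_antisymm (hfK s).2 (iInf₂_le _ (hfK s).1)⟩⟩

end Selection

/-! ### Extended-real integrals of differences -/

/-- For an integrable `h`, the extended-real integral of `g - h` is the difference of the
nonnegative integrals. -/
lemma erealIntegral_sub {Ω : Type*} [MeasurableSpace Ω] (m : Measure Ω) {g h : Ω → ℝ≥0∞}
    (hg : Measurable g) (hh : Measurable h) (hfin : ∀ ω, h ω ≠ ⊤) (hint : ∫⁻ ω, h ω ∂m ≠ ⊤) :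
    erealIntegral m (fun ω => (g ω : EReal) - (h ω : EReal)) =
      ((∫⁻ ω, g ω ∂m : ℝ≥0∞) : EReal) - ((∫⁻ ω, h ω ∂m : ℝ≥0∞) : EReal) := by
  have hpos : ∀ ω, ((g ω : EReal) - (h ω : EReal)).toENNReal = g ω - h ω := fun ω => by
    rw [EReal.toENNReal_sub (EReal.coe_ennreal_nonneg _), EReal.toENNReal_coe,
      EReal.toENNReal_coe]
  have hneg : ∀ ω, (-((g ω : EReal) - (h ω : EReal))).toENNReal = h ω - g ω := fun ω => by
    rw [EReal.neg_sub (Or.inl (by simp)) (Or.inr (by simpa using hfin ω)), add_comm,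
      ← sub_eq_add_neg, EReal.toENNReal_sub (EReal.coe_ennreal_nonneg _), EReal.toENNReal_coe,
      EReal.toENNReal_coe]
  simp only [erealIntegral, hpos, hneg]
  -- in truncated subtraction both sides are the integral of `max (g ω) (h ω)`
  have key : ∫⁻ ω, (g ω - h ω) ∂m + ∫⁻ ω, h ω ∂m = ∫⁻ ω, (h ω - g ω) ∂m + ∫⁻ ω, g ω ∂m := by
    rw [← lintegral_add_right _ hh, ← lintegral_add_right _ hg]
    refine lintegral_congr fun ω => ?_
    rw [tsub_add_eq_max, tsub_add_eq_max, max_comm]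
  have hN : ∫⁻ ω, (h ω - g ω) ∂m ≠ ⊤ :=
    ne_top_of_le_ne_top hint (lintegral_mono fun ω => tsub_le_self)
  generalize ∫⁻ ω, (g ω - h ω) ∂m = P at *
  generalize ∫⁻ ω, (h ω - g ω) ∂m = N at *
  generalize ∫⁻ ω, g ω ∂m = G at *
  generalize ∫⁻ ω, h ω ∂m = I at *
  lift N to ℝ≥0 using hN
  lift I to ℝ≥0 using hint
  rcases eq_or_ne P ⊤ with rfl | hP
  · have hG : G = ⊤ := by simpa using key.symm
    subst hG
    simp only [EReal.coe_ennreal_top, EReal.coe_nnreal_eq_coe_real, EReal.top_sub_coe]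
  · have hG : G ≠ ⊤ := by
      rintro rfl
      simp [hP] at key
    lift P to ℝ≥0 using hP
    lift G to ℝ≥0 using hG
    have key' : (P : ℝ) + I = N + G := by exact_mod_cast key
    simp only [EReal.coe_nnreal_eq_coe_real]
    rw [← EReal.coe_sub, ← EReal.coe_sub]
    congr 1
    linarith

lemma coe_ennreal_sub_ne_bot {g c : ℝ≥0∞} (hc : c ≠ ⊤) : (g : EReal) - (c : EReal) ≠ ⊥ := by
  lift c to ℝ≥0 using hc
  induction g with
  | top => simp
  | coe g =>
    simp only [EReal.coe_nnreal_eq_coe_real]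
    rw [← EReal.coe_sub]
    exact EReal.coe_ne_bot _

namespace RSPOMDP

variable {X Y A : Type*}
  [TopologicalSpace X] [MeasurableSpace X]
  [TopologicalSpace Y] [MeasurableSpace Y]
  [TopologicalSpace A] [MeasurableSpace A]
  {M : RSPOMDP X Y A}

/-! ### First-step decomposition of the trajectory law -/

/-- The trajectory that starts at `e` and continues with `ω`. -/
def consTraj (e : X × Y) (ω : ℕ → X × Y) : ℕ → X × Y
  | 0 => e
  | n + 1 => ω n

lemma measurable_consTraj (e : X × Y) : Measurable (consTraj e) := by
  refine measurable_pi_lambda _ fun i => ?_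
  cases i with
  | zero => exact measurable_const
  | succ n => exact measurable_pi_apply n

lemma update_consTraj (e : X × Y) (ω : ℕ → X × Y) (n : ℕ) (r : X × Y) :
    Function.update (consTraj e ω) (n + 1) r = consTraj e (Function.update ω n r) := by
  funext i
  cases i with
  | zero => simp [consTraj]
  | succ i => by_cases h : i = n <;> simp [consTraj, h]

/-- The admissible pair `(x, g₀(x))` that `π` produces at time `0` in state `x`. -/
def Policy.pair₀ (π : M.Policy) (x : X) : M.D := π.pair 0 (Fin.elim0, x)

/-- The policy that `π` induces after its first step, when that step was taken in the observable
state `x`. -/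
def Policy.shift (π : M.Policy) (x : X) : M.Policy where
  g n h := π.g (n + 1) (Fin.cons (π.pair₀ x) h.1, h.2)
  measurable_g n := by
    refine (π.measurable_g (n + 1)).comp (Measurable.prodMk ?_ measurable_snd)
    refine measurable_pi_lambda _ fun i => ?_
    refine Fin.cases ?_ (fun j => ?_) i
    · simp
    · simpa [Function.comp_def] using (measurable_pi_apply j).comp measurable_fst
  feasible_g n h := π.feasible_g (n + 1) (Fin.cons (π.pair₀ x) h.1, h.2)

/-- Prepending a first state to a trajectory prepends the first pair to the history, and the later
pairs are those of the shifted policy. -/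
lemma Policy.hist_consTraj (π : M.Policy) (x : X) (y : Y) (n : ℕ) (ω : ℕ → X × Y) :
    π.hist (n + 1) (consTraj (x, y) ω) =
      (Fin.cons (π.pair₀ x) ((π.shift x).hist n ω).1, ((π.shift x).hist n ω).2) := by
  induction n with
  | zero =>
    refine Prod.ext (funext fun i => ?_) rfl
    obtain rfl : i = Fin.last 0 := Fin.ext (by omega)
    rfl
  | succ n ih =>
    refine Prod.ext ?_ rfl
    change Fin.snoc (α := fun _ => ↥M.D) (π.hist (n + 1) (consTraj (x, y) ω)).1
      (π.pair (n + 1) (π.hist (n + 1) (consTraj (x, y) ω))) = _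
    rw [ih]
    exact (Fin.cons_snoc_eq_snoc_cons (β := M.D) _ _ _).symm

lemma Policy.pair_consTraj (π : M.Policy) (x : X) (y : Y) (n : ℕ) (ω : ℕ → X × Y) :
    π.pair (n + 1) (π.hist (n + 1) (consTraj (x, y) ω)) =
      (π.shift x).pair n ((π.shift x).hist n ω) := by
  rw [π.hist_consTraj]; rfl

lemma Policy.action_consTraj (π : M.Policy) (x : X) (y : Y) (n : ℕ) (ω : ℕ → X × Y) :
    π.action (n + 1) (consTraj (x, y) ω) = (π.shift x).action n ω := by
  rw [Policy.action, π.hist_consTraj]; rfl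

lemma Policy.hist_congr (π : M.Policy) {n : ℕ} {ω ω' : ℕ → X × Y} (h : ∀ i ≤ n, ω i = ω' i) :
    π.hist n ω = π.hist n ω' := by
  induction n with
  | zero => simp [Policy.hist, h 0 le_rfl]
  | succ n ih =>
    have := ih fun i hi => h i (by omega)
    simp [Policy.hist, this, h (n + 1) le_rfl]

variable [SecondCountableTopology X] [BorelSpace X] [SecondCountableTopology Y] [BorelSpace Y]
  [SecondCountableTopology A] [BorelSpace A] [TopologicalSpace.MetrizableSpace X]
  [TopologicalSpace.MetrizableSpace Y] [TopologicalSpace.MetrizableSpace A]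

lemma Policy.cost_consTraj (π : M.Policy) (x : X) (y : Y) (n : ℕ) (ω : ℕ → X × Y) :
    π.cost (n + 1) (consTraj (x, y) ω) =
      M.c x y (π.pair₀ x).1.2 + M.β * (π.shift x).cost n ω := by
  rw [Policy.cost, Finset.sum_range_succ', add_comm, Policy.cost, Finset.mul_sum]
  congr 1
  · simp only [pow_zero, one_mul]; rfl
  · refine Finset.sum_congr rfl fun k _ => ?_
    rw [π.action_consTraj, pow_succ', mul_assoc]; rfl

/-- The trajectory law as a kernel of the initial state. -/
def Policy.lawKernel (π : M.Policy) : Kernel (X × Y) (ℕ → X × Y) :=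
  (Kernel.traj (X := fun _ => X × Y) π.step 0).comap (fun r _ => r)
    (measurable_pi_lambda _ fun _ => measurable_id)

instance (π : M.Policy) : IsMarkovKernel π.lawKernel := by
  unfold Policy.lawKernel; infer_instance

instance (π : M.Policy) (x : X) (y : Y) : IsProbabilityMeasure (π.law x y) := by
  unfold Policy.law; infer_instance

/-- Under `ℙ^π_{xy}` the trajectory starts at `(x, y)`. -/
lemma Policy.ae_law_zero (π : M.Policy) (x : X) (y : Y) :
    ∀ᵐ ω ∂π.law x y, ω 0 = (x, y) := by
  have h : (π.law x y).map (Preorder.frestrictLe (π := fun _ => X × Y) 0) =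
      Measure.dirac (fun _ => (x, y)) := by
    rw [Policy.law, Kernel.traj_map_frestrictLe_apply, Kernel.partialTraj_self, Kernel.id_apply]
  have h0 : (π.law x y).map (fun ω => ω 0) = Measure.dirac (x, y) := by
    have hf : Measurable fun u : Finset.Iic 0 → X × Y => u ⟨0, Finset.mem_Iic.2 le_rfl⟩ :=
      measurable_pi_apply _
    rw [← Measure.map_dirac' hf (fun _ => (x, y)), ← h, Measure.map_map hf (by fun_prop)]
    rfl
  refine ae_of_ae_map (f := fun ω : ℕ → X × Y => ω 0) (p := fun e => e = (x, y))
    (measurable_pi_apply 0).aemeasurable ?_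
  rw [h0, ae_dirac_eq]
  exact rfl

/-- The law up to time `n + 1` arises from the law up to time `n` by one application of the
transition kernel. -/
lemma Policy.lintegral_law_succ (π : M.Policy) (x : X) (y : Y) (n : ℕ)
    {F : (ℕ → X × Y) → ℝ≥0∞} (hF : Measurable F)
    (hdep : ∀ ω ω', (∀ i ≤ n + 1, ω i = ω' i) → F ω = F ω') :
    ∫⁻ ω, F ω ∂π.law x y =
      ∫⁻ ω, ∫⁻ r, F (Function.update ω (n + 1) r)
        ∂M.Q (π.pair n (π.hist n ω), (ω n).2) ∂π.law x y := by
  have hupd : Measurable fun t : (Finset.Iic n → X × Y) × (X × Y) =>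
      Function.update (extend n t.1) (n + 1) t.2 := by
    refine measurable_pi_lambda _ fun i => ?_
    by_cases hi : i = n + 1
    · subst hi; simpa using measurable_snd
    · simpa [Function.update_of_ne hi, Function.comp_def] using
        (measurable_pi_apply i).comp ((measurable_extend n).comp measurable_fst)
  have hG : Measurable fun t : (Finset.Iic n → X × Y) × (X × Y) =>
      F (Function.update (extend n t.1) (n + 1) t.2) := hF.comp hupd
  have hext : ∀ (ω : ℕ → X × Y) (i : ℕ), i ≤ n →
      extend n (Preorder.frestrictLe (π := fun _ => X × Y) n ω) i = ω i := by
    intro ω i hi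
    simp [extend, min_eq_left hi]
  have hmap := Kernel.partialTraj_compProd_eq_map_traj (X := fun _ => X × Y) (κ := π.step)
    (Nat.zero_le n) (x₀ := fun _ => (x, y))
  have hR : Measurable fun ω : ℕ → X × Y =>
      (Preorder.frestrictLe (π := fun _ => X × Y) n ω, ω (n + 1)) := by fun_prop
  calc ∫⁻ ω, F ω ∂π.law x y
      = ∫⁻ t, F (Function.update (extend n t.1) (n + 1) t.2) ∂((π.law x y).map fun ω =>
          (Preorder.frestrictLe (π := fun _ => X × Y) n ω, ω (n + 1))) := by
        rw [lintegral_map hG hR]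
        refine lintegral_congr fun ω => hdep _ _ fun i hi => ?_
        rcases Nat.lt_or_ge n i with h | h
        · obtain rfl : i = n + 1 := by omega
          simp
        · rw [Function.update_of_ne (by omega), hext ω i h]
    _ = ∫⁻ ω, ∫⁻ r, F (Function.update ω (n + 1) r)
        ∂M.Q (π.pair n (π.hist n ω), (ω n).2) ∂π.law x y := by
        rw [Policy.law, ← hmap, Measure.lintegral_compProd hG,
          ← Kernel.traj_map_frestrictLe_apply, lintegral_map _ (by fun_prop)]
        · refine lintegral_congr fun ω => ?_
          have hh : π.hist n (extend n (Preorder.frestrictLe (π := fun _ => X × Y) n ω)) =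
            π.hist n ω := π.hist_congr fun i hi => hext ω i hi
          rw [Policy.step, Kernel.comap_apply, hh, hext ω n le_rfl]
          refine lintegral_congr fun r => hdep _ _ fun i hi => ?_
          rcases Nat.lt_or_ge n i with h | h
          · obtain rfl : i = n + 1 := by omega
            simp
          · rw [Function.update_of_ne (by omega), Function.update_of_ne (by omega), hext ω i h]
        · exact hG.lintegral_kernel_prod_right'

/-- First-step decomposition: after one transition from `(x, y)` the process evolves under the
shifted policy. -/
lemma Policy.lintegral_law_first (π : M.Policy) (x : X) (y : Y) (n : ℕ)
    {F : (ℕ → X × Y) → ℝ≥0∞} (hF : Measurable F)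
    (hdep : ∀ ω ω', (∀ i ≤ n + 1, ω i = ω' i) → F ω = F ω') :
    ∫⁻ ω, F ω ∂π.law x y =
      ∫⁻ r, ∫⁻ ω, F (consTraj (x, y) ω) ∂(π.shift x).law r.1 r.2 ∂M.Q (π.pair₀ x, y) := by
  induction n generalizing F with
  | zero =>
    rw [π.lintegral_law_succ x y 0 hF hdep]
    have h1 : ∀ᵐ ω ∂π.law x y, ∫⁻ r, F (Function.update ω (0 + 1) r)
        ∂M.Q (π.pair 0 (π.hist 0 ω), (ω 0).2) =
        ∫⁻ r, F (consTraj (x, y) fun _ => r) ∂M.Q (π.pair₀ x, y) := by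
      filter_upwards [π.ae_law_zero x y] with ω hω
      rw [Policy.hist, hω]
      refine lintegral_congr fun r => hdep _ _ fun i hi => ?_
      interval_cases i
      · simp [hω, consTraj]
      · simp [consTraj]
    rw [lintegral_congr_ae h1, lintegral_const, measure_univ, mul_one]
    refine lintegral_congr fun r => ?_
    have h2 : ∀ᵐ ω ∂(π.shift x).law r.1 r.2, F (consTraj (x, y) ω) =
        F (consTraj (x, y) fun _ => r) := by
      filter_upwards [(π.shift x).ae_law_zero r.1 r.2] with ω hω
      refine hdep _ _ fun i hi => ?_
      interval_cases i
      · rfl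
      · exact hω
    rw [lintegral_congr_ae h2, lintegral_const, measure_univ, mul_one]
  | succ n ih =>
    have hmeas : Measurable fun t : (ℕ → X × Y) × (X × Y) =>
        F (Function.update t.1 (n + 1 + 1) t.2) := by
      refine hF.comp (measurable_pi_lambda _ fun i => ?_)
      by_cases hi : i = n + 1 + 1
      · subst hi; simpa using measurable_snd
      · simpa [Function.update_of_ne hi, Function.comp_def] using
          (measurable_pi_apply i).comp measurable_fst
    let κ : Kernel (ℕ → X × Y) (X × Y) :=
      M.Q.comap (fun ω => (π.pair (n + 1) (π.hist (n + 1) ω), (ω (n + 1)).2))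
        (((π.measurable_pair _).comp (π.measurable_hist _)).prodMk (measurable_pi_apply _).snd)
    rw [π.lintegral_law_succ x y (n + 1) hF hdep, ih]
    · refine lintegral_congr fun r => ?_
      rw [(π.shift x).lintegral_law_succ r.1 r.2 n (F := fun ω => F (consTraj (x, y) ω))
        (hF.comp (measurable_consTraj _))]
      · refine lintegral_congr fun ω => ?_
        rw [π.pair_consTraj]
        refine lintegral_congr fun r' => ?_
        rw [update_consTraj]
      · intro ω ω' h
        refine hdep _ _ fun i hi => ?_
        cases i with
        | zero => rfl
        | succ i => exact h i (by omega)
    · exact Measurable.lintegral_kernel_prod_right' (κ := κ) hmeas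
    · intro ω ω' h
      rw [π.hist_congr h, h (n + 1) le_rfl]
      refine lintegral_congr fun r => hdep _ _ fun i hi => ?_
      by_cases hi' : i = n + 1 + 1
      · subst hi'; simp
      · rw [Function.update_of_ne hi', Function.update_of_ne hi', h i (by omega)]

/-! ### The shifted utility -/

variable (M) in
/-- The constant `U(0)⁻`, which makes the utility nonnegative when added to it. -/
def lowConst : ℝ≥0 := (-M.U 0).toNNReal

variable (M) in
/-- The nonnegative utility `U + U(0)⁻`. -/
def posU (s : ℝ≥0) : ℝ≥0 := (M.U s + M.lowConst).toNNReal

lemma coe_posU (s : ℝ≥0) : (M.posU s : ℝ) = M.U s + M.lowConst := by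
  refine Real.coe_toNNReal _ ?_
  have h1 := M.strictMono_U.monotone (zero_le : 0 ≤ s)
  have h2 : -M.U 0 ≤ M.lowConst := Real.le_coe_toNNReal _
  linarith

lemma continuous_posU : Continuous M.posU :=
  continuous_real_toNNReal.comp (M.continuous_U.add continuous_const)

lemma monotone_posU : Monotone M.posU := fun _ _ h =>
  Real.toNNReal_mono (add_le_add_left (M.strictMono_U.monotone h) _)

lemma Policy.measurable_cost (π : M.Policy) (n : ℕ) : Measurable (π.cost n) := by
  have hc := M.continuous_c.measurable
  refine Finset.measurable_sum _ fun k _ => Measurable.const_mul ?_ _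
  have ha : Measurable (π.action k) := (π.measurable_g k).comp (π.measurable_hist k)
  exact hc.comp ((measurable_pi_apply k).fst.prodMk ((measurable_pi_apply k).snd.prodMk ha))

lemma exists_cost_le (n : ℕ) : ∃ C : ℝ≥0, ∀ (π : M.Policy) (ω : ℕ → X × Y), π.cost n ω ≤ C := by
  obtain ⟨C, hC⟩ := M.bounded_c
  refine ⟨∑ k ∈ Finset.range n, M.β ^ k * C, fun π ω => Finset.sum_le_sum fun k _ => ?_⟩
  exact mul_le_mul_right (hC _ _ _) _

lemma Policy.cost_congr (π : M.Policy) {n : ℕ} {ω ω' : ℕ → X × Y}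
    (h : ∀ i < n, ω i = ω' i) : π.cost n ω = π.cost n ω' := by
  refine Finset.sum_congr rfl fun k hk => ?_
  have hk' := Finset.mem_range.1 hk
  rw [h k hk', Policy.action, Policy.action, π.hist_congr fun i hi => h i (hi.trans_lt hk')]

/-- The expected nonnegative utility of cost `s` so far and future costs scaled by `z`. -/
def Policy.expU (π : M.Policy) (n : ℕ) (z : ℝ≥0) (t : (X × Y) × ℝ≥0) : ℝ≥0∞ :=
  ∫⁻ ω, (M.posU (t.2 + z * π.cost n ω) : ℝ≥0∞) ∂π.law t.1.1 t.1.2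

lemma Policy.measurable_expU (π : M.Policy) (n : ℕ) (z : ℝ≥0) : Measurable (π.expU n z) := by
  have h : Measurable fun t : ((X × Y) × ℝ≥0) × (ℕ → X × Y) =>
      (M.posU (t.1.2 + z * π.cost n t.2) : ℝ≥0∞) := by
    have h1 : Measurable fun t : ((X × Y) × ℝ≥0) × (ℕ → X × Y) => π.cost n t.2 :=
      (π.measurable_cost n).comp measurable_snd
    exact (continuous_posU.measurable.comp
      ((measurable_fst.snd).add (h1.const_mul z))).coe_nnreal_ennreal
  exact Measurable.lintegral_kernel_prod_right' (κ := π.lawKernel.comap Prod.fst measurable_fst) h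

lemma Policy.expU_ne_top (π : M.Policy) (n : ℕ) (z : ℝ≥0) (t : (X × Y) × ℝ≥0) :
    π.expU n z t ≠ ⊤ := by
  obtain ⟨C, hC⟩ := exists_cost_le (M := M) n
  refine ne_top_of_le_ne_top (b := (M.posU (t.2 + z * C) : ℝ≥0∞)) ENNReal.coe_ne_top ?_
  calc π.expU n z t ≤ ∫⁻ _, (M.posU (t.2 + z * C) : ℝ≥0∞) ∂π.law t.1.1 t.1.2 :=
        lintegral_mono fun ω => ENNReal.coe_le_coe.2
          (monotone_posU (add_le_add_right (mul_le_mul_right (hC π ω) z) _))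
    _ = _ := by simp

lemma Policy.integral_U_eq (π : M.Policy) (n : ℕ) (z s : ℝ≥0) (x : X) (y : Y) :
    ∫ ω, M.U (s + z * π.cost n ω) ∂π.law x y =
      (π.expU n z ((x, y), s)).toReal - M.lowConst := by
  have hm : Measurable fun ω => (M.posU (s + z * π.cost n ω) : ℝ) :=
    (continuous_posU.measurable.comp
      (((π.measurable_cost n).const_mul z).const_add s)).coe_nnreal_real
  have hint : Integrable (fun ω => (M.posU (s + z * π.cost n ω) : ℝ)) (π.law x y) := by
    obtain ⟨C, hC⟩ := exists_cost_le (M := M) n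
    refine Integrable.of_bound hm.aestronglyMeasurable (M.posU (s + z * C))
      (ae_of_all _ fun ω => ?_)
    rw [Real.norm_of_nonneg (NNReal.coe_nonneg _)]
    exact_mod_cast monotone_posU (add_le_add_right (mul_le_mul_right (hC π ω) z) _)
  have h1 : ∀ ω, M.U (s + z * π.cost n ω) = M.posU (s + z * π.cost n ω) - M.lowConst :=
    fun ω => by rw [coe_posU]; ring
  simp_rw [h1]
  rw [integral_sub hint (integrable_const _), Policy.expU, lintegral_coe_eq_integral _ hint,
    ENNReal.toReal_ofReal (integral_nonneg fun ω => NNReal.coe_nonneg _)]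
  simp

variable (M) in
/-- The offset `U(0)⁻ μ(Y × ℝ₊)` by which passing to the nonnegative utility changes values. -/
def offset (μ : FiniteMeasure (Y × ℝ≥0)) : ℝ≥0∞ := ∫⁻ _, M.lowConst ∂(μ : Measure (Y × ℝ≥0))

lemma offset_eq (μ : FiniteMeasure (Y × ℝ≥0)) :
    M.offset μ = ((M.lowConst * μ.mass : ℝ≥0) : ℝ≥0∞) := by
  simp [offset]

lemma offset_ne_top (μ : FiniteMeasure (Y × ℝ≥0)) : M.offset μ ≠ ⊤ := by
  rw [offset_eq]; exact ENNReal.coe_ne_top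

variable (M) in
/-- The value function with respect to `U` that corresponds to the value function `g` with respect
to the nonnegative utility. -/
def ofPos (g : State X Y → ℝ≥0∞) (σ : State X Y) : EReal :=
  (g σ : EReal) - (M.offset σ.2.1 : EReal)

lemma ofPos_mono {g g' : State X Y → ℝ≥0∞} {σ : State X Y} (h : g σ ≤ g' σ) :
    M.ofPos g σ ≤ M.ofPos g' σ :=
  EReal.sub_le_sub (EReal.coe_ennreal_le_coe_ennreal_iff.2 h) le_rfl

/-- The value of a policy with respect to the nonnegative utility. -/
def posVpol (n : ℕ) (π : M.Policy) (σ : State X Y) : ℝ≥0∞ :=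
  ∫⁻ p, π.expU n σ.2.2 ((σ.1, p.1), p.2) ∂(σ.2.1 : Measure (Y × ℝ≥0))

lemma Vpol_eq (n : ℕ) (π : M.Policy) : Vpol n π = M.ofPos (posVpol n π) := by
  funext σ
  rw [Vpol, ofPos, posVpol, offset]
  rw [← erealIntegral_sub (g := fun p => π.expU n σ.2.2 ((σ.1, p.1), p.2)) _
    ((π.measurable_expU n _).comp (by fun_prop)) measurable_const
    (fun _ => ENNReal.coe_ne_top) (offset_ne_top σ.2.1)]
  congr 1
  funext p
  rw [π.integral_U_eq, EReal.coe_sub]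
  have h := π.expU_ne_top n σ.2.2 ((σ.1, p.1), p.2)
  generalize π.expU n σ.2.2 ((σ.1, p.1), p.2) = w at *
  lift w to ℝ≥0 using h
  rw [ENNReal.coe_toReal]
  rfl

variable (M) in
/-- The terminal value with respect to the nonnegative utility. -/
def posV0 (σ : State X Y) : ℝ≥0∞ := ∫⁻ p, M.posU p.2 ∂(σ.2.1 : Measure (Y × ℝ≥0))

lemma V0_eq : M.V0 = M.ofPos M.posV0 := by
  funext σ
  rw [V0, ofPos, posV0, offset]
  rw [← erealIntegral_sub (g := fun p => (M.posU p.2 : ℝ≥0∞)) _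
    ((continuous_posU.measurable.comp measurable_snd).coe_nnreal_ennreal) measurable_const
    (fun _ => ENNReal.coe_ne_top) (offset_ne_top σ.2.1)]
  congr 1
  funext p
  simp only [EReal.coe_nnreal_eq_coe_real]
  rw [← EReal.coe_sub, coe_posU]
  simp

lemma posVpol_zero (π : M.Policy) : posVpol 0 π = M.posV0 := by
  funext σ
  refine lintegral_congr fun p => ?_
  simp [Policy.expU, Policy.cost]

lemma posV0_le_posVpol (n : ℕ) (π : M.Policy) (σ : State X Y) : M.posV0 σ ≤ posVpol n π σ := by
  rw [← posVpol_zero π]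
  refine lintegral_mono fun p => lintegral_mono fun ω => ENNReal.coe_le_coe.2 (monotone_posU ?_)
  simp [Policy.cost]

/-! ### The update rule -/

lemma continuous_c_section (d : M.D) : Continuous fun y : Y => M.c d.1.1 y d.1.2 :=
  M.continuous_c.comp (g := fun p : X × Y × A => M.c p.1 p.2.1 p.2.2)
    (f := fun y : Y => (d.1.1, y, d.1.2)) (by fun_prop)

/-- Integration against the updated information state. -/
lemma lintegral_Ψ (d : M.D) (x' : X) (μ : FiniteMeasure (Y × ℝ≥0)) (z : ℝ≥0)
    {f : Y × ℝ≥0 → ℝ≥0∞} (hf : Measurable f) :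
    ∫⁻ p, f p ∂(M.Ψ d x' μ z : Measure (Y × ℝ≥0)) =
      ∫⁻ p, ∫⁻ y', (M.q x' y' d p.1 : ℝ≥0∞) * f (y', p.2 + z * M.c d.1.1 p.1 d.1.2)
        ∂(M.nu : Measure Y) ∂(μ : Measure (Y × ℝ≥0)) := by
  have hc := continuous_c_section d
  have hq : Continuous fun t : (Y × ℝ≥0) × Y => (M.q x' t.2 d t.1.1 : ℝ≥0∞) :=
    ENNReal.continuous_coe.comp (M.continuous_q.comp (g := fun p : X × Y × M.D × Y =>
      M.q p.1 p.2.1 p.2.2.1 p.2.2.2)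
      (f := fun t : (Y × ℝ≥0) × Y => (x', t.2, d, t.1.1)) (by fun_prop))
  have hmap : Measurable fun t : (Y × ℝ≥0) × Y => (t.2, t.1.2 + z * M.c d.1.1 t.1.1 d.1.2) := by
    have := hc.measurable
    fun_prop
  change ∫⁻ p, f p ∂(Measure.map _ _) = _
  rw [lintegral_map hf hmap, lintegral_withDensity_eq_lintegral_mul _ hq.measurable
    (g := fun t => f (t.2, t.1.2 + z * M.c d.1.1 t.1.1 d.1.2)) (hf.comp hmap)]
  exact lintegral_prod _ (hq.measurable.mul (hf.comp hmap)).aemeasurable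

/-- Averaging over the next observable state turns integrals against the updated information state
into integrals against the transition kernel. -/
lemma lintegral_lintegral_Ψ (d : M.D) (μ : FiniteMeasure (Y × ℝ≥0)) (z : ℝ≥0)
    {f : (X × Y) × ℝ≥0 → ℝ≥0∞} (hf : Measurable f) :
    Measurable (fun x' => ∫⁻ p, f ((x', p.1), p.2) ∂(M.Ψ d x' μ z : Measure (Y × ℝ≥0))) ∧
    ∫⁻ x', ∫⁻ p, f ((x', p.1), p.2) ∂(M.Ψ d x' μ z : Measure (Y × ℝ≥0)) ∂(M.lam : Measure X) =
      ∫⁻ p, ∫⁻ r, f (r, p.2 + z * M.c d.1.1 p.1 d.1.2) ∂M.Q (d, p.1)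
        ∂(μ : Measure (Y × ℝ≥0)) := by
  have hc := continuous_c_section d
  have hcm := hc.measurable
  have hq : Continuous fun t : (Y × ℝ≥0) × (X × Y) => (M.q t.2.1 t.2.2 d t.1.1 : ℝ≥0∞) :=
    ENNReal.continuous_coe.comp (M.continuous_q.comp (g := fun p : X × Y × M.D × Y =>
      M.q p.1 p.2.1 p.2.2.1 p.2.2.2)
      (f := fun t : (Y × ℝ≥0) × (X × Y) => (t.2.1, t.2.2, d, t.1.1)) (by fun_prop))
  have hF : Measurable fun t : (Y × ℝ≥0) × (X × Y) => (M.q t.2.1 t.2.2 d t.1.1 : ℝ≥0∞) *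
      f (t.2, t.1.2 + z * M.c d.1.1 t.1.1 d.1.2) :=
    hq.measurable.mul (hf.comp (by fun_prop))
  have h1 : ∀ x', ∫⁻ p, f ((x', p.1), p.2) ∂(M.Ψ d x' μ z : Measure (Y × ℝ≥0)) =
      ∫⁻ p, ∫⁻ y', (M.q x' y' d p.1 : ℝ≥0∞) * f ((x', y'), p.2 + z * M.c d.1.1 p.1 d.1.2)
        ∂(M.nu : Measure Y) ∂(μ : Measure (Y × ℝ≥0)) := fun x' =>
    lintegral_Ψ d x' μ z (f := fun p => f ((x', p.1), p.2)) (hf.comp (by fun_prop))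
  have hF2 : Measurable fun t : X × (Y × ℝ≥0) => ∫⁻ y', (M.q t.1 y' d t.2.1 : ℝ≥0∞) *
      f ((t.1, y'), t.2.2 + z * M.c d.1.1 t.2.1 d.1.2) ∂(M.nu : Measure Y) :=
    Measurable.lintegral_prod_right' (f := fun t : (X × (Y × ℝ≥0)) × Y =>
      (M.q t.1.1 t.2 d t.1.2.1 : ℝ≥0∞) * f ((t.1.1, t.2), t.1.2.2 + z * M.c d.1.1 t.1.2.1 d.1.2))
      (hF.comp (by fun_prop : Measurable fun t : (X × (Y × ℝ≥0)) × Y => (t.1.2, (t.1.1, t.2))))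
  simp_rw [h1]
  refine ⟨hF2.lintegral_prod_right', ?_⟩
  rw [lintegral_lintegral_swap hF2.aemeasurable]
  refine lintegral_congr fun p => ?_
  have hFp : Measurable fun r : X × Y => (M.q r.1 r.2 d p.1 : ℝ≥0∞) *
      f (r, p.2 + z * M.c d.1.1 p.1 d.1.2) := hF.comp (by fun_prop : Measurable fun r => (p, r))
  rw [Q, Kernel.lintegral_withDensity _ M.measurable_density _
    (g := fun r => f (r, p.2 + z * M.c d.1.1 p.1 d.1.2)) (hf.comp (by fun_prop)),
    Kernel.const_apply, lintegral_prod _ hFp.aemeasurable]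

/-- The update rule is jointly continuous: tested against a bounded continuous function, it is the
integral against `μ` of a bounded continuous function of `(x, a, x', z)` and `(y, s)`. -/
lemma continuous_Ψ : Continuous fun t : (M.D × X × ℝ≥0) × FiniteMeasure (Y × ℝ≥0) =>
    M.Ψ t.1.1 t.1.2.1 t.2 t.1.2.2 := by
  rw [FiniteMeasure.continuous_iff_forall_continuous_integral]
  intro f
  obtain ⟨C, hC⟩ := M.bounded_q
  have hF : Continuous fun t : ((M.D × X × ℝ≥0) × (Y × ℝ≥0)) × Y =>
      (M.q t.1.1.2.1 t.2 t.1.1.1 t.1.2.1 : ℝ) *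
        f (t.2, t.1.2.2 + t.1.1.2.2 * M.c t.1.1.1.1.1 t.1.2.1 t.1.1.1.1.2) := by
    have h1 : Continuous fun t : ((M.D × X × ℝ≥0) × (Y × ℝ≥0)) × Y =>
        M.q t.1.1.2.1 t.2 t.1.1.1 t.1.2.1 :=
      M.continuous_q.comp (g := fun p : X × Y × M.D × Y => M.q p.1 p.2.1 p.2.2.1 p.2.2.2)
        (f := fun t : ((M.D × X × ℝ≥0) × (Y × ℝ≥0)) × Y =>
          (t.1.1.2.1, t.2, t.1.1.1, t.1.2.1)) (by fun_prop)
    have h2 : Continuous fun t : ((M.D × X × ℝ≥0) × (Y × ℝ≥0)) × Y =>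
        M.c t.1.1.1.1.1 t.1.2.1 t.1.1.1.1.2 :=
      M.continuous_c.comp (g := fun p : X × Y × A => M.c p.1 p.2.1 p.2.2)
        (f := fun t : ((M.D × X × ℝ≥0) × (Y × ℝ≥0)) × Y =>
          (t.1.1.1.1.1, t.1.2.1, t.1.1.1.1.2)) (by fun_prop)
    fun_prop
  have hb : ∀ t : ((M.D × X × ℝ≥0) × (Y × ℝ≥0)) × Y,
      ‖(M.q t.1.1.2.1 t.2 t.1.1.1 t.1.2.1 : ℝ) *
        f (t.2, t.1.2.2 + t.1.1.2.2 * M.c t.1.1.1.1.1 t.1.2.1 t.1.1.1.1.2)‖ ≤ C * ‖f‖ := by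
    intro t
    rw [norm_mul, Real.norm_of_nonneg (NNReal.coe_nonneg _)]
    exact mul_le_mul (by exact_mod_cast hC _ _ _ _) (f.norm_coe_le_norm _) (norm_nonneg _)
      (NNReal.coe_nonneg _)
  have hF' : Continuous fun t : (M.D × X × ℝ≥0) × (Y × ℝ≥0) =>
      ∫ y', (M.q t.1.2.1 y' t.1.1 t.2.1 : ℝ) *
        f (y', t.2.2 + t.1.2.2 * M.c t.1.1.1.1 t.2.1 t.1.1.1.2) ∂(M.nu : Measure Y) := by
    refine continuous_of_dominated (bound := fun _ => C * ‖f‖) (fun t => ?_) (fun t => ?_)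
      (integrable_const _) (ae_of_all _ fun y' => ?_)
    · exact (hF.comp (by fun_prop : Continuous fun y' : Y => (t, y'))).aestronglyMeasurable
    · exact ae_of_all _ fun y' => hb (t, y')
    · exact hF.comp (by fun_prop :
        Continuous fun t : (M.D × X × ℝ≥0) × (Y × ℝ≥0) => (t, y'))
  have hb' : ∀ (t : M.D × X × ℝ≥0) (p : Y × ℝ≥0),
      |∫ y', (M.q t.2.1 y' t.1 p.1 : ℝ) *
        f (y', p.2 + t.2.2 * M.c t.1.1.1 p.1 t.1.1.2) ∂(M.nu : Measure Y)| ≤ C * ‖f‖ := by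
    intro t p
    have := norm_integral_le_of_norm_le_const (μ := (M.nu : Measure Y))
      (ae_of_all _ fun y' => hb ((t, p), y'))
    simpa using this
  convert continuous_integral_param hF' hb' using 1
  funext ⟨⟨d, x', z⟩, μ⟩
  have hFd : Continuous fun t : (Y × ℝ≥0) × Y => (M.q x' t.2 d t.1.1 : ℝ) *
      f (t.2, t.1.2 + z * M.c d.1.1 t.1.1 d.1.2) :=
    hF.comp (by fun_prop : Continuous fun t : (Y × ℝ≥0) × Y => ((((d, x', z), t.1) :
      (M.D × X × ℝ≥0) × (Y × ℝ≥0)), t.2))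
  have hc := continuous_c_section d
  have hq : Continuous fun t : (Y × ℝ≥0) × Y => M.q x' t.2 d t.1.1 :=
    M.continuous_q.comp (g := fun p : X × Y × M.D × Y => M.q p.1 p.2.1 p.2.2.1 p.2.2.2)
      (f := fun t : (Y × ℝ≥0) × Y => (x', t.2, d, t.1.1)) (by fun_prop)
  have hmap : Measurable fun t : (Y × ℝ≥0) × Y => (t.2, t.1.2 + z * M.c d.1.1 t.1.1 d.1.2) := by
    have := hc.measurable
    fun_prop
  change ∫ p, f p ∂(Measure.map _ _) = _
  rw [integral_map hmap.aemeasurable f.continuous.aestronglyMeasurable,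
    integral_withDensity_eq_integral_smul hq.measurable]
  simp only [NNReal.smul_def, smul_eq_mul]
  rw [integral_prod _ (Integrable.of_bound hFd.aestronglyMeasurable (C * ‖f‖)
    (ae_of_all _ fun t => hb (((d, x', z), t.1), t.2)))]

/-! ### One-step recursion for the value of a policy -/

variable (M) in
/-- `∫ g(x', Ψ(x, a, x', μ, z), βz) λ(dx')` for a nonnegative `g`. -/
def nextPos (g : State X Y → ℝ≥0∞) (d : M.D) (μ : FiniteMeasure (Y × ℝ≥0))
    (z : Ioc (0 : ℝ≥0) 1) : ℝ≥0∞ :=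
  ∫⁻ x', g (x', M.Ψ d x' μ (z : ℝ≥0), M.disc * z) ∂(M.lam : Measure X)

lemma nextPos_mono {g g' : State X Y → ℝ≥0∞} (h : ∀ σ, g σ ≤ g' σ) (d : M.D)
    (μ : FiniteMeasure (Y × ℝ≥0)) (z : Ioc (0 : ℝ≥0) 1) :
    M.nextPos g d μ z ≤ M.nextPos g' d μ z :=
  lintegral_mono fun _ => h _

/-- The offset is preserved in the mean, since `q` is a probability density. -/
lemma expNext_ofPos {g : State X Y → ℝ≥0∞} {d : M.D} {μ : FiniteMeasure (Y × ℝ≥0)}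
    {z : Ioc (0 : ℝ≥0) 1} (hg : Measurable fun x' => g (x', M.Ψ d x' μ (z : ℝ≥0), M.disc * z)) :
    M.expNext (M.ofPos g) d μ z = (M.nextPos g d μ z : EReal) - (M.offset μ : EReal) := by
  obtain ⟨hm, hi⟩ := lintegral_lintegral_Ψ d μ (z : ℝ≥0) (M := M)
    (f := fun _ => (M.lowConst : ℝ≥0∞)) measurable_const
  have hi' : ∫⁻ x', M.offset (M.Ψ d x' μ (z : ℝ≥0)) ∂(M.lam : Measure X) = M.offset μ := by
    refine hi.trans (lintegral_congr fun p => ?_)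
    simp
  have := erealIntegral_sub (M.lam : Measure X) hg hm (fun x' => offset_ne_top _)
    (by rw [hi]; simpa [offset] using offset_ne_top (M := M) μ)
  rw [expNext, nextPos, ← hi']
  exact this

/-- First-step decomposition of the expected utility. -/
lemma Policy.expU_succ (π : M.Policy) (n : ℕ) (z : ℝ≥0) (x : X) (y : Y) (s : ℝ≥0) :
    π.expU (n + 1) z ((x, y), s) =
      ∫⁻ r, (π.shift x).expU n (M.β * z) (r, s + z * M.c x y (π.pair₀ x).1.2)
        ∂M.Q (π.pair₀ x, y) := by
  have hm : Measurable fun ω => (M.posU (s + z * π.cost (n + 1) ω) : ℝ≥0∞) :=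
    (continuous_posU.measurable.comp
      (((π.measurable_cost (n + 1)).const_mul z).const_add s)).coe_nnreal_ennreal
  rw [Policy.expU]
  simp only
  rw [π.lintegral_law_first x y n hm fun ω ω' h => by
    rw [π.cost_congr fun i hi => h i hi.le]]
  refine lintegral_congr fun r => lintegral_congr fun ω => ?_
  rw [π.cost_consTraj]
  congr 2
  ring

/-- One-step recursion for the value of a policy. The shifted policy depends on the current state
`x` but not on the next state `x'`. -/
lemma posVpol_succ (π : M.Policy) (n : ℕ) (x : X) (μ : FiniteMeasure (Y × ℝ≥0))
    (z : Ioc (0 : ℝ≥0) 1) :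
    (Measurable fun x' => posVpol n (π.shift x)
      (x', M.Ψ (π.pair₀ x) x' μ (z : ℝ≥0), M.disc * z)) ∧
    posVpol (n + 1) π (x, μ, z) = M.nextPos (posVpol n (π.shift x)) (π.pair₀ x) μ z := by
  obtain ⟨hm, hi⟩ := lintegral_lintegral_Ψ (π.pair₀ x) μ (z : ℝ≥0)
    ((π.shift x).measurable_expU n (M.β * z))
  refine ⟨hm, ?_⟩
  refine Eq.trans ?_ hi.symm
  exact lintegral_congr fun p => π.expU_succ n z x p.1 p.2

lemma Vpol_succ (π : M.Policy) (n : ℕ) (x : X) (μ : FiniteMeasure (Y × ℝ≥0))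
    (z : Ioc (0 : ℝ≥0) 1) :
    Vpol (n + 1) π (x, μ, z) = M.expNext (Vpol n (π.shift x)) (π.pair₀ x) μ z := by
  obtain ⟨hm, h⟩ := posVpol_succ π n x μ z
  rw [Vpol_eq, Vpol_eq, expNext_ofPos hm, ← h]
  rfl

/-! ### Markov policies -/

/-- The initial observable state of a history. -/
def Hist.first : {n : ℕ} → M.Hist n → X
  | 0, h => h.2
  | _ + 1, h => (h.1 0).1.1

lemma Hist.first_prev {n : ℕ} (h : M.Hist (n + 1)) : h.prev.first = h.first := by
  cases n <;> rfl

/-- The information states after a first step are those of the process restarted from the updated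
information state. -/
lemma infoState_cons (μ : FiniteMeasure (Y × ℝ≥0)) (z : Ioc (0 : ℝ≥0) 1) (d : M.D) (n : ℕ)
    (h : M.Hist n) :
    infoState (M := M) μ z (n + 1) (Fin.cons d h.1, h.2) =
      infoState (M.Ψ d h.first μ (z : ℝ≥0)) (M.disc * z) n h := by
  induction n with
  | zero => simp [infoState, Hist.first]
  | succ n ih =>
    have hprev : Hist.prev (M := M) (n := n + 1) (Fin.cons d h.1, h.2) =
        (Fin.cons d h.prev.1, h.prev.2) := by
      refine Prod.ext (funext fun i => ?_) rfl
      refine Fin.cases ?_ (fun j => ?_) i <;> rfl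
    rw [infoState, hprev, ih, Hist.first_prev]
    conv_rhs => rw [infoState]
    have hz : (M.disc ^ (n + 1) * z : Ioc (0 : ℝ≥0) 1) = M.disc ^ n * (M.disc * z) := by
      rw [pow_succ, mul_assoc]
    rw [hz]
    rfl

/-- A policy that agrees with a Markov policy up to the horizon, on the histories that start in
the given state, has the iterated cost of that Markov policy. -/
theorem Vpol_eq_iterT (n : ℕ) (π : M.Policy) (f : ℕ → M.Strategy) (x : X)
    (μ : FiniteMeasure (Y × ℝ≥0)) (z : Ioc (0 : ℝ≥0) 1)
    (hπ : ∀ k < n, ∀ h : M.Hist k, h.first = x →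
      π.g k h = (f k).f (h.2, infoState μ z k h, M.disc ^ k * z)) :
    Vpol n π (x, μ, z) = iterT n f (x, μ, z) := by
  induction n generalizing π f x μ z with
  | zero => rw [iterT, Vpol_eq, V0_eq, posVpol_zero]
  | succ n ih =>
    have h0 : π.pair₀ x = ⟨(x, (f 0).f (x, μ, z)), (f 0).feasible_f (x, μ, z)⟩ := by
      refine Subtype.ext (Prod.ext rfl ?_)
      have := hπ 0 n.succ_pos (Fin.elim0, x) rfl
      rw [pow_zero, one_mul] at this
      exact this
    rw [Vpol_succ, iterT, T, ← h0, expNext, expNext]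
    congr 1
    funext x'
    -- the shifted policy follows the shifted strategies on the histories that start in `x'` only,
    -- since its information states involve the actual first state of the history
    refine ih _ _ _ _ _ fun k hk h hx => ?_
    have := hπ (k + 1) (by omega) (Fin.cons (π.pair₀ x) h.1, h.2) rfl
    rw [infoState_cons, hx, pow_succ, mul_assoc] at this
    exact this

/-- Information states depend continuously on the history. -/
lemma continuous_infoState (μ : FiniteMeasure (Y × ℝ≥0)) (z : Ioc (0 : ℝ≥0) 1) (n : ℕ) :
    Continuous (infoState (M := M) μ z n) := by
  induction n with
  | zero => exact continuous_const
  | succ n ih =>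
    have hprev : Continuous fun h : M.Hist (n + 1) => h.prev := by
      unfold Hist.prev
      fun_prop
    exact continuous_Ψ.comp (Continuous.prodMk (Continuous.prodMk
      ((continuous_apply (Fin.last n)).comp continuous_fst)
      (continuous_snd.prodMk continuous_const)) (ih.comp hprev))

/-- The actions of a Markov policy are measurable functions of the history, although strategies are
only Borel for the weak topology, because the information states are continuous in the history. -/
lemma exists_follows (f : ℕ → M.Strategy) (μ : FiniteMeasure (Y × ℝ≥0))
    (z : Ioc (0 : ℝ≥0) 1) : ∃ π : M.Policy, π.Follows f μ z := by
  refine ⟨⟨fun k h => (f k).f (h.2, infoState μ z k h, M.disc ^ k * z), fun k => ?_,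
    fun k h => (f k).feasible_f (h.2, _, _)⟩, fun k h => rfl⟩
  have hc : Continuous fun h : M.Hist k =>
      ((h.2, infoState μ z k h, M.disc ^ k * z) : State X Y) :=
    continuous_snd.prodMk ((continuous_infoState μ z k).prodMk continuous_const)
  let _ : MeasurableSpace (State X Y) := borel (State X Y)
  have : BorelSpace (State X Y) := ⟨rfl⟩
  exact (f k).measurable_f.comp hc.measurable

instance : Nonempty M.Policy := by
  obtain ⟨s, hs, hD⟩ := M.exists_selector
  exact ⟨⟨fun _ h => s h.2, fun _ => hs.comp measurable_snd, fun _ h => hD h.2⟩⟩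

/-! ### The value iteration and its minimizers -/

variable (M) in
/-- The Bellman iterates for the nonnegative utility. -/
def posV : ℕ → State X Y → ℝ≥0∞
  | 0 => M.posV0
  | n + 1 => fun σ => ⨅ a : M.feasible σ.1, M.nextPos (posV n) ⟨(σ.1, (a : A)), a.2⟩ σ.2.1 σ.2.2

/-- No policy, Markov or not, does better than the Bellman iterates. -/
lemma posV_le_posVpol (n : ℕ) (π : M.Policy) (σ : State X Y) :
    M.posV n σ ≤ posVpol n π σ := by
  induction n generalizing π σ with
  | zero => rw [posVpol_zero]; rfl
  | succ n ih =>
    obtain ⟨x, μ, z⟩ := σ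
    rw [(posVpol_succ π n x μ z).2]
    refine (iInf_le _ (⟨(π.pair₀ x).1.2, (π.pair₀ x).2⟩ : M.feasible x)).trans ?_
    exact nextPos_mono (fun σ => ih _ σ) _ _ _

/-- An upper hemicontinuous correspondence with compact values has a closed graph. -/
lemma isClosed_D (hD : UpperHemicontinuous M.feasible) : IsClosed M.D := by
  refine IsSeqClosed.isClosed fun u p hu hp => ?_
  have h1 := UpperHemicontinuousAt.mem_of_tendsto (hD p.1) (M.isCompact_D p.1).isClosed
    ((continuous_fst.tendsto p).comp hp) (y := fun n => (u n).2)
    (Filter.Eventually.of_forall fun n => (hu n : (u n).2 ∈ M.feasible (u n).1)).frequently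
    ((continuous_snd.tendsto p).comp hp)
  exact h1

/-- Sections along the transition of a lower semicontinuous function are measurable. -/
lemma measurable_next {g : State X Y → ℝ≥0∞} (hg : LowerSemicontinuous g) (d : M.D)
    (μ : FiniteMeasure (Y × ℝ≥0)) (z : Ioc (0 : ℝ≥0) 1) :
    Measurable fun x' => g (x', M.Ψ d x' μ (z : ℝ≥0), M.disc * z) := by
  refine (hg.comp (g := fun x' => (x', M.Ψ d x' μ (z : ℝ≥0), M.disc * z)) ?_).measurable
  refine continuous_id.prodMk (Continuous.prodMk ?_ continuous_const)
  exact continuous_Ψ.comp (by fun_prop :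
    Continuous fun x' : X => (((d, x', (z : ℝ≥0)), μ) : (M.D × X × ℝ≥0) × FiniteMeasure (Y × ℝ≥0)))

lemma lowerSemicontinuous_nextPos {g : State X Y → ℝ≥0∞} (hg : LowerSemicontinuous g) :
    LowerSemicontinuous fun t : M.D × FiniteMeasure (Y × ℝ≥0) × Ioc (0 : ℝ≥0) 1 =>
      M.nextPos g t.1 t.2.1 t.2.2 := by
  refine lowerSemicontinuous_lintegral _ (w := fun x'
    (t : M.D × FiniteMeasure (Y × ℝ≥0) × Ioc (0 : ℝ≥0) 1) =>
      g (x', M.Ψ t.1 x' t.2.1 (t.2.2 : ℝ≥0), M.disc * t.2.2))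
    (fun t => measurable_next hg t.1 t.2.1 t.2.2) fun x' => ?_
  refine hg.comp (g := fun t : M.D × FiniteMeasure (Y × ℝ≥0) × Ioc (0 : ℝ≥0) 1 =>
    ((x', M.Ψ t.1 x' t.2.1 (t.2.2 : ℝ≥0), M.disc * t.2.2) : State X Y)) ?_
  have h1 : Continuous fun t : M.D × FiniteMeasure (Y × ℝ≥0) × Ioc (0 : ℝ≥0) 1 =>
      M.Ψ t.1 x' t.2.1 (t.2.2 : ℝ≥0) :=
    continuous_Ψ.comp (by fun_prop :
      Continuous fun t : M.D × FiniteMeasure (Y × ℝ≥0) × Ioc (0 : ℝ≥0) 1 =>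
        (((t.1, x', (t.2.2 : ℝ≥0)), t.2.1) : (M.D × X × ℝ≥0) × FiniteMeasure (Y × ℝ≥0)))
  have h2 : Continuous fun t : M.D × FiniteMeasure (Y × ℝ≥0) × Ioc (0 : ℝ≥0) 1 =>
      M.disc * t.2.2 := by
    refine Continuous.subtype_mk ?_ _
    fun_prop
  exact continuous_const.prodMk (h1.prodMk h2)

/-- Minimizing the expected next value over the feasible actions preserves lower semicontinuity and
can be done by a Borel measurable strategy. -/
theorem minimize_nextPos (hD : UpperHemicontinuous M.feasible) {g : State X Y → ℝ≥0∞}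
    (hg : LowerSemicontinuous g) :
    (LowerSemicontinuous fun σ : State X Y => ⨅ a : M.feasible σ.1,
      M.nextPos g ⟨(σ.1, (a : A)), a.2⟩ σ.2.1 σ.2.2) ∧
    ∃ f : M.Strategy, ∀ σ : State X Y,
      M.nextPos g ⟨(σ.1, f.f σ), f.feasible_f σ⟩ σ.2.1 σ.2.2 =
        ⨅ a : M.feasible σ.1, M.nextPos g ⟨(σ.1, (a : A)), a.2⟩ σ.2.1 σ.2.2 := by
  classical
  -- the objective lives on the closed graph of `D`; off the graph it is set to `⊤`
  let K : State X Y → Set A := fun σ => M.feasible σ.1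
  have hK : UpperHemicontinuous K := 
    UpperHemicontinuous.comp (f := M.feasible) (g := fun σ : State X Y => σ.1) hD continuous_fst
  have hcomp : ∀ σ, IsCompact (K σ) := fun σ => M.isCompact_D σ.1
  have hne : ∀ σ, (K σ).Nonempty := fun σ => by
    obtain ⟨s, -, hs⟩ := M.exists_selector
    exact ⟨s σ.1, hs σ.1⟩
  let C : Set (State X Y × A) := {p | (p.1.1, p.2) ∈ M.D}
  have hC : IsClosed C := (isClosed_D hD).preimage (by fun_prop)
  let G : C → ℝ≥0∞ := fun p => M.nextPos g ⟨(p.1.1.1, p.1.2), p.2⟩ p.1.1.2.1 p.1.1.2.2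
  have hG : LowerSemicontinuous G := by
    refine (lowerSemicontinuous_nextPos hg).comp (g := fun p : C =>
      ((⟨(p.1.1.1, p.1.2), p.2⟩, p.1.1.2.1, p.1.1.2.2) :
        M.D × FiniteMeasure (Y × ℝ≥0) × Ioc (0 : ℝ≥0) 1)) ?_
    exact (Continuous.subtype_mk (by fun_prop) _).prodMk (by fun_prop)
  let H : State X Y × A → ℝ≥0∞ := fun p => if h : p ∈ C then G ⟨p, h⟩ else ⊤
  have hH : LowerSemicontinuous H := lowerSemicontinuous_extend_top hC hG
  have hHK : ∀ (σ : State X Y) (a : A) (ha : a ∈ M.feasible σ.1),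
      H (σ, a) = M.nextPos g ⟨(σ.1, a), ha⟩ σ.2.1 σ.2.2 := fun σ a ha =>
    dif_pos (show (σ, a) ∈ C from ha)
  have hinf : ∀ σ, ⨅ a ∈ K σ, H (σ, a) =
      ⨅ a : M.feasible σ.1, M.nextPos g ⟨(σ.1, (a : A)), a.2⟩ σ.2.1 σ.2.2 := fun σ => by
    rw [iInf_subtype']
    exact iInf_congr fun a => hHK σ a a.2
  refine ⟨?_, ?_⟩
  · simpa only [hinf] using lowerSemicontinuous_biInf hK hcomp hH
  · let _ : MeasurableSpace (State X Y) := borel (State X Y)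
    have : BorelSpace (State X Y) := ⟨rfl⟩
    obtain ⟨f, hf, hfm⟩ := exists_measurable_minimizer hne hcomp hK hH
    refine ⟨⟨f, hf, fun σ => (hfm σ).1⟩, fun σ => ?_⟩
    rw [← hinf, ← (hfm σ).2, hHK σ _ (hfm σ).1]

lemma lowerSemicontinuous_posV (hD : UpperHemicontinuous M.feasible) (n : ℕ) :
    LowerSemicontinuous (M.posV n) := by
  induction n with
  | zero =>
    exact (lowerSemicontinuous_lintegral_finiteMeasure
      (continuous_posU.comp continuous_snd)).comp
        (by fun_prop : Continuous fun σ : State X Y => σ.2.1)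
  | succ n ih => exact (minimize_nextPos hD ih).1

lemma lowerSemicontinuous_ofPos {g : State X Y → ℝ≥0∞} (hg : LowerSemicontinuous g) :
    LowerSemicontinuous (M.ofPos g) := by
  have h1 : LowerSemicontinuous fun σ => (g σ : EReal) :=
    continuous_coe_ennreal_ereal.comp_lowerSemicontinuous hg
      fun _ _ h => EReal.coe_ennreal_le_coe_ennreal_iff.2 h
  have h2 : Continuous fun σ : State X Y => -((M.lowConst * σ.2.1.mass : ℝ≥0) : ℝ) := by fun_prop
  have h3 : M.ofPos g = fun σ =>
      (g σ : EReal) + ((-((M.lowConst * σ.2.1.mass : ℝ≥0) : ℝ) : ℝ) : EReal) := by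
    funext σ
    rw [ofPos, offset_eq, EReal.coe_neg, ← sub_eq_add_neg]
    rfl
  rw [h3]
  refine h1.add' (continuous_coe_real_ereal.comp h2).lowerSemicontinuous fun σ => ?_
  exact EReal.continuousAt_add (Or.inr (EReal.coe_ne_bot _)) (Or.inr (EReal.coe_ne_top _))

/-- The Bellman operator acts on the values for `U` as on those for the nonnegative utility. The
infimum commutes with subtracting the offset because it is attained. -/
lemma bellman_posV (hD : UpperHemicontinuous M.feasible) (n : ℕ) :
    M.bellman (M.ofPos (M.posV n)) = M.ofPos (M.posV (n + 1)) := by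
  have hlsc := lowerSemicontinuous_posV hD n
  obtain ⟨f, hf⟩ := (minimize_nextPos hD hlsc).2
  funext σ
  rw [bellman]
  simp only [expNext_ofPos (measurable_next hlsc _ _ _)]
  refine le_antisymm ((iInf_le _ (⟨f.f σ, f.feasible_f σ⟩ : M.feasible σ.1)).trans ?_)
    (le_iInf fun a => ?_)
  · rw [hf σ]; exact le_rfl
  · exact EReal.sub_le_sub (EReal.coe_ennreal_le_coe_ennreal_iff.2 (iInf_le _ a)) le_rfl

lemma exists_minimizer_posV (hD : UpperHemicontinuous M.feasible) (n : ℕ) :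
    ∃ f : M.Strategy, f.IsMinimizer (M.ofPos (M.posV n)) := by
  have hlsc := lowerSemicontinuous_posV hD n
  obtain ⟨f, hf⟩ := (minimize_nextPos hD hlsc).2
  refine ⟨f, fun σ => ?_⟩
  rw [bellman_posV hD, T, expNext_ofPos (measurable_next hlsc _ _ _), hf σ]
  rfl

/-- Applying minimizers in reverse order, the iterated cost is the Bellman iterate. -/
lemma iterT_of_isMinimizer (hD : UpperHemicontinuous M.feasible) (N : ℕ) (f : ℕ → M.Strategy)
    (hf : ∀ n, 1 ≤ n → n ≤ N → (f n).IsMinimizer (M.ofPos (M.posV (n - 1)))) :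
    iterT N (fun k => f (N - k)) = M.ofPos (M.posV N) := by
  induction N with
  | zero => rw [iterT, V0_eq]; rfl
  | succ N ih =>
    have h1 : (fun k => f (N + 1 - (k + 1))) = fun k => f (N - k) := by
      funext k
      rw [Nat.add_sub_add_right]
    rw [iterT, h1, ih fun n h1 h2 => hf n h1 (by omega), ← bellman_posV hD]
    funext σ
    exact hf (N + 1) (by omega) le_rfl σ

/-- The value functions are the Bellman iterates. -/
theorem V_eq (hD : UpperHemicontinuous M.feasible) (n : ℕ) : M.V n = M.ofPos (M.posV n) := by
  choose m hm using exists_minimizer_posV (M := M) hD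
  funext σ
  obtain ⟨x, μ, z⟩ := σ
  refine le_antisymm ?_ (le_iInf fun π => ?_)
  -- the minimizer of the iterate with `n - k - 1` steps is applied at time `k`
  · obtain ⟨π, hπ⟩ := exists_follows (fun k => m (n - k - 1)) μ z
    refine (iInf_le _ π).trans (le_of_eq ?_)
    rw [Vpol_eq_iterT n π _ x μ z fun k _ h _ => hπ k h,
      iterT_of_isMinimizer hD n (fun j => m (j - 1)) fun j _ _ => hm _]
  · rw [Vpol_eq]
    exact ofPos_mono (posV_le_posVpol n π _)

lemma V0_le_Vpol (n : ℕ) (π : M.Policy) (σ : State X Y) : M.V0 σ ≤ Vpol n π σ := by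
  rw [V0_eq, Vpol_eq]
  exact ofPos_mono (posV0_le_posVpol n π σ)

lemma Vpol_ne_top (n : ℕ) (π : M.Policy) (σ : State X Y)
    (hσ : ∀ t : ℝ≥0, Integrable (fun p : Y × ℝ≥0 => M.U (p.2 + t))
      (σ.2.1 : Measure (Y × ℝ≥0))) : Vpol n π σ ≠ ⊤ := by
  obtain ⟨C, hC⟩ := exists_cost_le (M := M) n
  have hfin : posVpol n π σ ≠ ⊤ := by
    have hint : Integrable (fun p : Y × ℝ≥0 => (M.posU (p.2 + C) : ℝ))
        (σ.2.1 : Measure (Y × ℝ≥0)) := by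
      simp only [coe_posU]
      exact (hσ C).add (integrable_const _)
    refine ne_top_of_le_ne_top (b := ∫⁻ p, M.posU (p.2 + C) ∂(σ.2.1 : Measure (Y × ℝ≥0))) ?_ ?_
    · rw [lintegral_coe_eq_integral _ hint]
      exact ENNReal.ofReal_ne_top
    · refine lintegral_mono fun p => ?_
      calc π.expU n σ.2.2 ((σ.1, p.1), p.2) ≤ ∫⁻ _, (M.posU (p.2 + C) : ℝ≥0∞) ∂π.law σ.1 p.1 := by
            refine lintegral_mono fun ω => ENNReal.coe_le_coe.2 (monotone_posU ?_)
            refine add_le_add_right ?_ _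
            exact (mul_le_of_le_one_left zero_le σ.2.2.2.2).trans (hC π ω)
        _ = _ := by simp
  rw [Vpol_eq, ofPos, offset_eq]
  generalize posVpol n π σ = w at *
  lift w to ℝ≥0 using hfin
  simp only [EReal.coe_nnreal_eq_coe_real]
  rw [← EReal.coe_sub]
  exact EReal.coe_ne_top _

/-- The objective `J_{Nπ}(x)` is the value of `π` in the information state `Q₀^Y × δ₀`. -/
lemma Vpol_infoInit (N : ℕ) (π : M.Policy) (x : X) :
    Vpol N π (x, M.infoInit, 1) = (J N π x : EReal) := by
  obtain ⟨C, hC⟩ := exists_cost_le (M := M) N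
  have hm : Measurable fun y => π.expU N 1 ((x, y), 0) :=
    (π.measurable_expU N 1).comp (by fun_prop)
  have hle : ∀ y, π.expU N 1 ((x, y), 0) ≤ M.posU C := fun y => by
    calc π.expU N 1 ((x, y), 0) ≤ ∫⁻ _, (M.posU C : ℝ≥0∞) ∂π.law x y :=
          lintegral_mono fun ω => ENNReal.coe_le_coe.2 (monotone_posU (by simpa using hC π ω))
      _ = _ := by simp
  have hpos : posVpol N π (x, M.infoInit, 1) = ∫⁻ y, π.expU N 1 ((x, y), 0) ∂M.initY := by
    change ∫⁻ p, π.expU N 1 ((x, p.1), p.2) ∂(M.initY.prod (Measure.dirac 0)) = _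
    have hm' : Measurable fun p : Y × ℝ≥0 => π.expU N 1 ((x, p.1), p.2) :=
      (π.measurable_expU N 1).comp (by fun_prop)
    rw [lintegral_prod _ hm'.aemeasurable]
    exact lintegral_congr fun y => lintegral_dirac' _ (hm'.comp measurable_prodMk_left)
  have hfin : ∫⁻ y, π.expU N 1 ((x, y), 0) ∂M.initY ≠ ⊤ := by
    refine ne_top_of_le_ne_top (b := (M.posU C : ℝ≥0∞)) ENNReal.coe_ne_top ?_
    calc _ ≤ ∫⁻ _, (M.posU C : ℝ≥0∞) ∂M.initY := lintegral_mono hle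
      _ = _ := by simp
  have hoff : M.offset M.infoInit = M.lowConst := by
    have : (M.infoInit : Measure (Y × ℝ≥0)) = M.initY.prod (Measure.dirac 0) := rfl
    rw [offset, this]
    simp
  have hJ : J N π x = (∫⁻ y, π.expU N 1 ((x, y), 0) ∂M.initY).toReal - M.lowConst := by
    have h1 : ∀ y, ∫ ω, M.U (π.cost N ω) ∂π.law x y =
        (π.expU N 1 ((x, y), 0)).toReal - M.lowConst := fun y => by
      simpa using π.integral_U_eq N 1 0 x y
    have hint : Integrable (fun y => (π.expU N 1 ((x, y), 0)).toReal) M.initY :=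
      integrable_toReal_of_lintegral_ne_top hm.aemeasurable hfin
    rw [J]
    simp only [h1]
    rw [integral_sub hint (integrable_const _), integral_toReal hm.aemeasurable
      (ae_of_all _ fun y => (hle y).trans_lt ENNReal.coe_lt_top)]
    simp
  rw [Vpol_eq, ofPos, hpos, hoff, hJ]
  generalize ∫⁻ y, π.expU N 1 ((x, y), 0) ∂M.initY = w at *
  lift w to ℝ≥0 using hfin
  rw [ENNReal.coe_toReal]
  rfl

end RSPOMDP

end

theorem mainTheorem2 {X Y A : Type*}
    [TopologicalSpace X] [TopologicalSpace.MetrizableSpace X] [SecondCountableTopology X]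
    [MeasurableSpace X] [BorelSpace X] [StandardBorelSpace X]
    [TopologicalSpace Y] [TopologicalSpace.MetrizableSpace Y] [SecondCountableTopology Y]
    [MeasurableSpace Y] [BorelSpace Y] [StandardBorelSpace Y]
    [TopologicalSpace A] [TopologicalSpace.MetrizableSpace A] [SecondCountableTopology A]
    [MeasurableSpace A] [BorelSpace A] [StandardBorelSpace A]
    (M : RSPOMDP X Y A) :
    -- (a) cost iteration for Markov policies
    (∀ (f : ℕ → M.Strategy) (μ : FiniteMeasure (Y × ℝ≥0)) (z : Ioc (0 : ℝ≥0) 1),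
      ∃ π : M.Policy, π.Follows f μ z ∧
        ∀ (n : ℕ) (x : X), RSPOMDP.Vpol n π (x, μ, z) = RSPOMDP.iterT n f (x, μ, z)) ∧
    (UpperHemicontinuous M.feasible →
      -- (b) value functions and Bellman recursion
      (∀ n : ℕ, M.V n ∈ M.classV ∧
        (∀ σ : RSPOMDP.State X Y, M.V n σ ≠ ⊥ ∧
          ((∀ t : ℝ≥0, Integrable (fun p : Y × ℝ≥0 => M.U (p.2 + t))
            (σ.2.1 : Measure (Y × ℝ≥0))) → M.V n σ ≠ ⊤)) ∧
        ∀ σ : RSPOMDP.State X Y, M.V (n + 1) σ = M.bellman (M.V n) σ) ∧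
      -- (c) minimizers and the optimal policy
      (∀ n : ℕ, ∃ f : M.Strategy, f.IsMinimizer (M.V n)) ∧
      ∀ (N : ℕ) (f : ℕ → M.Strategy),
        (∀ n, 1 ≤ n → n ≤ N → (f n).IsMinimizer (M.V (n - 1))) →
        (∃ π : M.Policy, ∀ n < N, ∀ h : M.Hist n,
          π.g n h = (f (N - n)).f (h.2, RSPOMDP.infoState M.infoInit 1 n h, M.disc ^ n)) ∧
        ∀ π : M.Policy,
          (∀ n < N, ∀ h : M.Hist n,
            π.g n h = (f (N - n)).f (h.2, RSPOMDP.infoState M.infoInit 1 n h, M.disc ^ n)) →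
          ∀ x : X, RSPOMDP.J N π x = M.Jopt N x) := by
  refine ⟨fun f μ z => ?_, fun hD => ⟨fun n => ⟨⟨?_, fun σ => ?_⟩, fun σ => ⟨?_, fun hσ => ?_⟩,
    fun σ => ?_⟩, fun n => ?_, fun N f hf => ⟨?_, fun π hπ x => ?_⟩⟩⟩
  · obtain ⟨π, hπ⟩ := RSPOMDP.exists_follows f μ z
    exact ⟨π, hπ, fun n x => RSPOMDP.Vpol_eq_iterT n π f x μ z fun k _ h _ => hπ k h⟩
  · rw [RSPOMDP.V_eq hD]
    exact RSPOMDP.lowerSemicontinuous_ofPos (RSPOMDP.lowerSemicontinuous_posV hD n)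
  · exact le_iInf fun π => RSPOMDP.V0_le_Vpol n π σ
  · rw [RSPOMDP.V_eq hD]
    exact coe_ennreal_sub_ne_bot (RSPOMDP.offset_ne_top _)
  · have π : M.Policy := Classical.arbitrary _
    exact ne_top_of_le_ne_top (RSPOMDP.Vpol_ne_top n π σ hσ) (iInf_le _ π)
  · rw [RSPOMDP.V_eq hD, RSPOMDP.V_eq hD, RSPOMDP.bellman_posV hD]
  · rw [RSPOMDP.V_eq hD]
    exact RSPOMDP.exists_minimizer_posV hD n
  · obtain ⟨π, hπ⟩ := RSPOMDP.exists_follows (fun k => f (N - k)) M.infoInit 1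
    refine ⟨π, fun n _ h => ?_⟩
    rw [hπ n h, mul_one]
  · have hval : RSPOMDP.Vpol N π (x, M.infoInit, 1) = M.V N (x, M.infoInit, 1) := by
      rw [RSPOMDP.Vpol_eq_iterT N π (fun k => f (N - k)) x M.infoInit 1 fun k hk h _ => by
        rw [hπ k hk h, mul_one], RSPOMDP.iterT_of_isMinimizer hD N f fun n h1 h2 => by
        rw [← RSPOMDP.V_eq hD]; exact hf n h1 h2, RSPOMDP.V_eq hD]
    have hmin : ∀ π' : M.Policy, RSPOMDP.J N π x ≤ RSPOMDP.J N π' x := fun π' => by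
      rw [← EReal.coe_le_coe_iff, ← RSPOMDP.Vpol_infoInit, ← RSPOMDP.Vpol_infoInit, hval]
      exact iInf_le _ π'
    exact le_antisymm (le_ciInf hmin) (ciInf_le ⟨_, by rintro _ ⟨π', rfl⟩; exact hmin π'⟩ π)
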